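/- Let $d\ge 0$, $b:\mathbb R^d\to\mathbb R^d$, and let $J\in[0,\infty)$, $K,L,R\in(0,\infty)$ be such that for all $x,y\in\mathbb R^d$: (C1) $(x-y)\cdot(b(x)-b(y))\le J|x-y|^2$; (C2) $(x-y)\cdot(b(x)-b(y))\le -K|x-y|^2$ if $|x-y|\ge R$; (C3) $|b(x)-b(y)|\le L|x-y|$. **Coupling.** For a step size $h>0$ put $\hat x=x+hb(x)$, $\hat y=y+hb(y)$, $\hat e=(\hat x-\hat y)/|\hat x-\hat y|$ if $\hat x\ne\hat y$ and $\hat e=0$ otherwise. Let $\phi_{m,hI}(z)=(2\pi h)^{-d/2}e^{-|z-m|^2/(2h)}$, and let $Z\sim N(0,I_d)$ and $U\sim\mathrm{Unif}(0,1)$ be independent. The coupling $(X',Y')$ of the Euler steps from $x$ and $y$ is $X'=\hat x+\sqrt h\,Z$, and $Y'=X'$ if $U\le\phi_{\hat y,hI}(X')/\phi_{\hat x,hI}(X')$, $Y'=\hat y+\sqrt h\,(I_d-2\hat e\hat e^T)Z$ otherwise. Expectations under it are denoted by $\mathbb E_{x,y}$. **Constants.** With $\phi_{0,1}$ the standard normal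 density, let $p_0=\int_1^\infty\phi_{0,1}(t)\,dt$, $\tilde c_0=\frac1{16}\int_{1/4}^{3/8}(1-e^{u-1/2})\phi_{0,1}(u)\,du$, and $$\Lambda=\min(L,J+L^2h/2),\quad r_2=R+\sqrt{2\tilde c_0/K},\quad h_0=\frac1L\min\Big(\frac{p_0}2,\frac KL,\frac1{64\,L\,r_2^2}\Big).$$ **Metric.** Let $\varphi(r)=\exp\big(-\tilde c_0^{-1}\Lambda((r\wedge R)^2+2\sqrt h\,(r\wedge R))\big)$ and $\Phi(r)=\int_0^r\varphi(s)\,ds$. Let $\underline\alpha(u)=\tilde c_0h\,1_{\sqrt h\le u\le 1/(4L\sqrt h)}$ and $\hat I_s=(s,s+\sqrt h)\cap(\sqrt h,\infty)$. For $a\ge 0$ put $$G(r)=\int_0^r\frac1{\varphi(s)}\sup_{u\in\hat I_s}\frac{a+\Phi(u)}{\underline\alpha(u)}\,ds\in[0,\infty],\quad c=\min\Big(\frac{p_0}2,\frac1{4\,G(r_2)}\Big),\quad g_a(r)=1-2c\,G(r),$$ with the conventions $t/0=\infty$ for $t>0$, $1/\infty=0$, $0\cdot\infty=0$ (for $h<h_0$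 all these quantities are finite when $r\le r_2$), and $$\rho_a(x,y)=a1_{x\ne y}+f_a(|x-y|),\qquad f_a(r)=\int_0^r g_a(s\wedge r_2)\,\varphi(s\wedge r_2)\,ds.$$ **Theorem.** Let $a\in[2\sqrt h,\Phi(R)]$ and $$c_2(a)=\frac18\min\left(\frac{K\varphi(R)}{1+(a+\sqrt h)\sqrt{2K/\tilde c_0}},\ \frac{2\tilde c_0\,\varphi(R)}{R^2+2(a+\sqrt h)R},\ \frac{4p_0}h\right).$$ Then $g_a(0)=1$, and $g_a$ is non-increasing on $[0,r_2]$ with values in $[\frac12,1]$. If moreover $h\in(0,h_0)$, then $\rho_a(X',Y')$ is integrable and $$\mathbb E_{x,y}[\rho_a(X',Y')]\le(1-c_2(a)h)\,\rho_a(x,y)\qquad\text{for all }x,y\in\mathbb R^d.$$ -/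

import Mathlib

open MeasureTheory ProbabilityTheory
open scoped ENNReal

noncomputable section

namespace EulerCoupling

/-! ### Universal constants -/

/-- `p₀ = ∫_1^∞ φ_{0,1}(t) dt`, the standard normal tail at `1`. -/
def p0 : ℝ := ∫ t in Set.Ioi (1 : ℝ), gaussianPDFReal 0 1 t

/-- `c̃₀ = (1/16) ∫_{1/4}^{3/8} (1 - e^{u - 1/2}) φ_{0,1}(u) du`. -/
def c0t : ℝ := (1 / 16) * ∫ u in (1 / 4 : ℝ)..(3 / 8 : ℝ),
  (1 - Real.exp (u - 1 / 2)) * gaussianPDFReal 0 1 u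

/-! ### The coupling of two Euler steps -/

section Coupling

variable {d : ℕ}

/-- Deterministic part of the Euler step, `x̂ = x + h b(x)`. -/
def drift (b : EuclideanSpace ℝ (Fin d) → EuclideanSpace ℝ (Fin d)) (h : ℝ)
    (x : EuclideanSpace ℝ (Fin d)) : EuclideanSpace ℝ (Fin d) :=
  x + h • b x

/-- Density of the normal distribution `N(m, h I_d)`. -/
def gaussDensity (h : ℝ) (m z : EuclideanSpace ℝ (Fin d)) : ℝ :=
  (2 * Real.pi * h) ^ (-((d : ℝ) / 2)) * Real.exp (-(‖z - m‖ ^ 2 / (2 * h)))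

/-- The unit vector `(u - v) / |u - v|`, and `0` if `u = v`. -/
def unitDir (u v : EuclideanSpace ℝ (Fin d)) : EuclideanSpace ℝ (Fin d) :=
  ‖u - v‖⁻¹ • (u - v)

/-- `X' = x̂ + √h z`. -/
def stepX (b : EuclideanSpace ℝ (Fin d) → EuclideanSpace ℝ (Fin d)) (h : ℝ)
    (x z : EuclideanSpace ℝ (Fin d)) : EuclideanSpace ℝ (Fin d) :=
  drift b h x + Real.sqrt h • z

/-- `Y'_refl = ŷ + √h (I - 2 ê êᵀ) z`. -/
def stepRefl (b : EuclideanSpace ℝ (Fin d) → EuclideanSpace ℝ (Fin d)) (h : ℝ)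
    (x y z : EuclideanSpace ℝ (Fin d)) : EuclideanSpace ℝ (Fin d) :=
  drift b h y + Real.sqrt h •
    (z - (2 * inner ℝ (unitDir (drift b h x) (drift b h y)) z) •
      unitDir (drift b h x) (drift b h y))

open Classical in
/-- `Y' = X'` if `u ≤ φ_{ŷ,hI}(X') / φ_{x̂,hI}(X')`, and `Y' = Y'_refl` otherwise. -/
def stepY (b : EuclideanSpace ℝ (Fin d) → EuclideanSpace ℝ (Fin d)) (h : ℝ)
    (x y z : EuclideanSpace ℝ (Fin d)) (u : ℝ) : EuclideanSpace ℝ (Fin d) :=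
  if u ≤ gaussDensity h (drift b h y) (stepX b h x z) /
        gaussDensity h (drift b h x) (stepX b h x z)
  then stepX b h x z
  else stepRefl b h x y z

end Coupling

/-! ### The metric and the rate -/

/-- `Λ = min(L, J + L² h / 2)`. -/
def Lam (J L h : ℝ) : ℝ := min L (J + L ^ 2 * h / 2)

/-- `r₂ = R + √(2 c̃₀ / K)`. -/
def r2 (K R : ℝ) : ℝ := R + Real.sqrt (2 * c0t / K)

/-- `h₀ = (1/L) min(p₀/2, K/L, 1/(64 L r₂²))`. -/
def h0 (K L R : ℝ) : ℝ := (1 / L) * min (p0 / 2) (min (K / L) (1 / (64 * L * r2 K R ^ 2)))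

/-- `φ(r) = exp(-c̃₀⁻¹ Λ ((r ∧ R)² + 2 √h (r ∧ R)))`. -/
def phi (J L R h r : ℝ) : ℝ :=
  Real.exp (-(c0t⁻¹ * Lam J L h * ((min r R) ^ 2 + 2 * Real.sqrt h * min r R)))

/-- `Φ(r) = ∫_0^r φ(s) ds`. -/
def Phi (J L R h r : ℝ) : ℝ := ∫ s in (0 : ℝ)..r, phi J L R h s

open Classical in
/-- Lower bound `c̃₀ h 1_{√h ≤ r ≤ 1/(4 L √h)}` for the fluctuations. -/
def alphaLow (L h r : ℝ) : ℝ :=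
  if Real.sqrt h ≤ r ∧ r ≤ 1 / (4 * L * Real.sqrt h) then c0t * h else 0

/-- The dual interval `(s, s + √h) ∩ (√h, ∞)`. -/
def dualInterval (h s : ℝ) : Set ℝ :=
  Set.Ioo s (s + Real.sqrt h) ∩ Set.Ioi (Real.sqrt h)

/-- `G(r) = ∫_0^r φ(s)⁻¹ sup_{u ∈ Î_s} (a + Φ(u)) / α(u) ds`, computed in `[0, ∞]`. -/
def G (J L R h a r : ℝ) : ℝ≥0∞ :=
  ∫⁻ s in Set.Ioc 0 r, ENNReal.ofReal (1 / phi J L R h s) *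
    ⨆ u ∈ dualInterval h s,
      ENNReal.ofReal (a + Phi J L R h u) / ENNReal.ofReal (alphaLow L h u)

/-- `c = min(p₀/2, (1/4) G(r₂)⁻¹)`. -/
def cRate (J K L R h a : ℝ) : ℝ≥0∞ :=
  min (ENNReal.ofReal (p0 / 2)) (4⁻¹ * (G J L R h a (r2 K R))⁻¹)

/-- `g_a(r) = 1 - 2 c G(r)`. -/
def ga (J K L R h a r : ℝ) : ℝ :=
  1 - 2 * (cRate J K L R h a * G J L R h a r).toReal

/-- `f_a(r) = ∫_0^r g_a(s ∧ r₂) φ(s ∧ r₂) ds`. -/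
def fa (J K L R h a r : ℝ) : ℝ :=
  ∫ s in (0 : ℝ)..r, ga J K L R h a (min s (r2 K R)) * phi J L R h (min s (r2 K R))

open Classical in
/-- `ρ_a(x, y) = a 1_{x ≠ y} + f_a(|x - y|)`. -/
def rho {d : ℕ} (J K L R h a : ℝ) (x y : EuclideanSpace ℝ (Fin d)) : ℝ :=
  (if x ≠ y then a else 0) + fa J K L R h a ‖x - y‖

/-- The rate
`c₂(a) = (1/8) min(K φ(R) / (1 + (a + √h) √(2K/c̃₀)), 2 c̃₀ φ(R) / (R² + 2 (a + √h) R), 4 p₀ / h)`. -/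
def c2 (J K L R h a : ℝ) : ℝ :=
  (1 / 8) * min (K * phi J L R h R / (1 + (a + Real.sqrt h) * Real.sqrt (2 * K / c0t)))
    (min (2 * c0t * phi J L R h R / (R ^ 2 + 2 * (a + Real.sqrt h) * R)) (4 * p0 / h))

end EulerCoupling

end

/-! The distance after a coupled step is `√h * gap q (n, u)` with `q = |x̂ - ŷ| / √h`, `n` the noise
component along the reflection direction and `u` the uniform variable (`norm_stepX_sub_stepY`). It
thus suffices to bound the mean of one function of a two-dimensional noise. Three facts about `gap`
enter: its mean is exactly `q` (`integral_gap`); it vanishes with probability at least `p0` when `q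
≤ 2` (`integral_gap_ne_zero_le`); and it fluctuates to the left with truncated second moment at
least `2 * c0t` (`le_integral_cutSq_gap`).

Since `fa` is concave, the tangent at `r = |x - y|` bounds its mean by `f(r) + f'(r)(s - r)`, where
`s = |x̂ - ŷ|`. The gain needed for contraction has a different source in each of three regimes
(`integral_radial_gap_le`). For `r ≤ √h`, merging removes at least `p0 * a` from the discontinuous
part, and `2√h ≤ a` makes this dominate `f`. For `√h < r ≤ r₂`, strict concavity paired with the
left fluctuations gives a second-order gain: the decay of `phi` pays for the expansive drift, and
that of `ga` leaves a surplus `2c(a + Φ(r))` (`slope_sub_ge`). For `r > r₂`, the drift itself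
contracts and the slope of `fa` is at least `φ(R)/2`. The remaining estimates show that `c2` is
below the rate obtained in each regime. -/

namespace EulerCoupling

/-! ### Integrals of non-increasing functions -/

section Antitone

variable {w : ℝ → ℝ}

lemma intervalIntegrable_of_antitoneOn_Ici (hw : AntitoneOn w (Set.Ici 0)) {s t : ℝ}
    (hs : 0 ≤ s) (ht : 0 ≤ t) : IntervalIntegrable w volume s t := by
  apply AntitoneOn.intervalIntegrable
  intro x hx y hy hxy
  rw [Set.mem_uIcc] at hx hy
  refine hw ?_ ?_ hxy <;> rw [Set.mem_Ici] <;> grind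

/-- A primitive of a non-increasing function lies below its tangents; the gap is quadratic where
the function decreases at least linearly. -/
lemma integral_le_tangent_sub_sq (hw : AntitoneOn w (Set.Ici 0)) {r s m : ℝ}
    (hr : 0 ≤ r) (hs : 0 ≤ s) (hsr : s ≤ r) (hm : ∀ t ∈ Set.Ioo s r, 2 * m * (r - t) ≤ w t - w r) :
    ∫ t in (0 : ℝ)..s, w t ≤ (∫ t in (0 : ℝ)..r, w t) + w r * (s - r) - m * (s - r) ^ 2 := by
  have h1 := intervalIntegral.integral_add_adjacent_intervals
    (intervalIntegrable_of_antitoneOn_Ici hw le_rfl hs)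
    (intervalIntegrable_of_antitoneOn_Ici hw hs hr)
  have h2 : ∫ t in s..r, (w r + 2 * m * (r - t)) ≤ ∫ t in s..r, w t := by
    apply intervalIntegral.integral_mono_on_of_le_Ioo hsr
    · exact (Continuous.intervalIntegrable (by fun_prop) _ _)
    · exact intervalIntegrable_of_antitoneOn_Ici hw hs hr
    · intro t ht
      linarith [hm t ht]
  have h3 : ∫ t in s..r, (w r + 2 * m * (r - t)) = w r * (r - s) + m * (r - s) ^ 2 := by
    have hd : ∀ t ∈ Set.uIcc s r,
        HasDerivAt (fun t => w r * t - m * (r - t) ^ 2) (w r + 2 * m * (r - t)) t := by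
      intro t _
      refine (((hasDerivAt_id t).const_mul (w r)).sub
        ((((hasDerivAt_id t).const_sub r).pow 2).const_mul m)).congr_deriv ?_
      simp only [id_eq, Nat.cast_ofNat]
      ring
    rw [intervalIntegral.integral_eq_sub_of_hasDerivAt hd
      (Continuous.intervalIntegrable (by fun_prop) _ _)]
    ring
  nlinarith

lemma integral_le_tangent (hw : AntitoneOn w (Set.Ici 0)) {r s : ℝ} (hr : 0 ≤ r) (hs : 0 ≤ s) :
    ∫ t in (0 : ℝ)..s, w t ≤ (∫ t in (0 : ℝ)..r, w t) + w r * (s - r) := by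
  rcases le_total s r with hsr | hrs
  · have := integral_le_tangent_sub_sq hw (m := 0) hr hs hsr (by
      intro t ht
      have := hw (a := t) (b := r) (by simpa using hs.trans ht.1.le) hr ht.2.le
      linarith)
    linarith
  · have h1 := intervalIntegral.integral_add_adjacent_intervals
      (intervalIntegrable_of_antitoneOn_Ici hw le_rfl hr)
      (intervalIntegrable_of_antitoneOn_Ici hw hr hs)
    have h2 : ∫ t in r..s, w t ≤ ∫ t in r..s, w r := by
      apply intervalIntegral.integral_mono_on hrs
        (intervalIntegrable_of_antitoneOn_Ici hw hr hs) (by simp)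
      intro t ht
      exact hw hr (hr.trans ht.1) ht.1
    rw [intervalIntegral.integral_const, smul_eq_mul] at h2
    linarith

end Antitone

/-! ### Constants -/

lemma c0t_pos : 0 < c0t := by
  unfold c0t
  refine mul_pos (by norm_num) ?_
  apply intervalIntegral.intervalIntegral_pos_of_pos_on _ _ (by norm_num)
  · apply Continuous.intervalIntegrable
    unfold gaussianPDFReal
    fun_prop
  · intro u hu
    refine mul_pos ?_ (gaussianPDFReal_pos _ _ _ (by simp))
    have : Real.exp (u - 1 / 2) < 1 := by
      rw [Real.exp_lt_one_iff]
      linarith [hu.2]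
    linarith

lemma p0_eq_gaussianReal : p0 = (gaussianReal 0 1).real (Set.Ioi 1) := by
  rw [p0, measureReal_def, gaussianReal_apply_eq_integral _ (by simp), ENNReal.toReal_ofReal]
  exact integral_nonneg fun x => gaussianPDFReal_nonneg _ _ _

lemma p0_pos : 0 < p0 := by
  unfold p0
  rw [setIntegral_pos_iff_support_of_nonneg_ae]
  · have : Function.support (gaussianPDFReal 0 1) = Set.univ := by
      ext x
      simp [(gaussianPDFReal_pos 0 1 x (by simp)).ne']
    simp [this]
  · exact Filter.Eventually.of_forall fun x => gaussianPDFReal_nonneg _ _ _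
  · exact (integrable_gaussianPDFReal 0 1).integrableOn

lemma p0_le_one : p0 ≤ 1 := by
  rw [p0_eq_gaussianReal]
  exact measureReal_le_one

lemma Lam_nonneg {J L h : ℝ} (hJ : 0 ≤ J) (hL : 0 ≤ L) (hh : 0 ≤ h) : 0 ≤ Lam J L h := by
  unfold Lam
  positivity

lemma lt_r2 {K R : ℝ} (hK : 0 < K) : R < r2 K R := by
  have := c0t_pos
  unfold r2
  linarith [Real.sqrt_pos.2 (show 0 < 2 * c0t / K by positivity)]

/-! ### The functions `φ` and `Φ` -/

section Phi

variable {J L R h : ℝ}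

lemma phi_pos (r : ℝ) : 0 < phi J L R h r := Real.exp_pos _

lemma continuous_phi : Continuous (phi J L R h) := by
  unfold phi
  fun_prop

lemma phi_antitoneOn (hJ : 0 ≤ J) (hL : 0 ≤ L) (hR : 0 ≤ R) (hh : 0 ≤ h) :
    AntitoneOn (phi J L R h) (Set.Ici 0) := by
  intro s hs t ht hst
  have := c0t_pos
  have := Lam_nonneg hJ hL hh
  rw [Set.mem_Ici] at hs ht
  unfold phi
  have : min s R ≤ min t R := min_le_min hst le_rfl
  have : 0 ≤ min s R := le_min hs hR
  gcongr

lemma phi_le_one (hJ : 0 ≤ J) (hL : 0 ≤ L) (hR : 0 ≤ R) (hh : 0 ≤ h) {s : ℝ} (hs : 0 ≤ s) :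
    phi J L R h s ≤ 1 := by
  have := c0t_pos
  have := Lam_nonneg hJ hL hh
  have : 0 ≤ min s R := le_min hs hR
  unfold phi
  rw [Real.exp_le_one_iff]
  have : 0 ≤ c0t⁻¹ * Lam J L h * (min s R ^ 2 + 2 * √h * min s R) := by positivity
  linarith

lemma phi_of_le {s : ℝ} (hs : R ≤ s) : phi J L R h s = phi J L R h R := by
  simp [phi, min_eq_right hs]

lemma phi_R_le (hJ : 0 ≤ J) (hL : 0 ≤ L) (hR : 0 ≤ R) (hh : 0 ≤ h) {s : ℝ} (hs : 0 ≤ s) :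
    phi J L R h R ≤ phi J L R h s := by
  rcases le_total s R with h1 | h1
  · exact phi_antitoneOn hJ hL hR hh hs hR h1
  · exact (phi_of_le h1).ge

/-- Decay of `φ` to the left of `r ≤ R`. -/
lemma phi_sub_ge (hJ : 0 ≤ J) (hL : 0 ≤ L) (hh : 0 ≤ h) {t r : ℝ} (htr : t ≤ r)
    (hrt : r - √h ≤ t) (hrR : r ≤ R) :
    phi J L R h r * (c0t⁻¹ * Lam J L h * (2 * r) * (r - t)) ≤ phi J L R h t - phi J L R h r := by
  have hc := c0t_pos
  have hl := Lam_nonneg hJ hL hh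
  set A := c0t⁻¹ * Lam J L h with hA
  have hA0 : 0 ≤ A := by positivity
  have h1 : phi J L R h t =
      phi J L R h r * Real.exp (A * ((r - t) * (r + t + 2 * √h))) := by
    unfold phi
    rw [← Real.exp_add, min_eq_left hrR, min_eq_left (htr.trans hrR), ← hA]
    congr 1
    ring
  have h2 := Real.add_one_le_exp (A * ((r - t) * (r + t + 2 * √h)))
  have h3 : A * (2 * r) * (r - t) ≤ A * ((r - t) * (r + t + 2 * √h)) := by
    rw [mul_assoc A, mul_comm (2 * r)]
    have : 0 ≤ r - t := by linarith
    gcongr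
    linarith [Real.sqrt_nonneg h]
  have h4 := phi_pos (J := J) (L := L) (R := R) (h := h) r
  rw [h1]
  nlinarith

lemma Phi_nonneg {r : ℝ} (hr : 0 ≤ r) : 0 ≤ Phi J L R h r :=
  intervalIntegral.integral_nonneg hr fun _ _ => (phi_pos _).le

lemma Phi_le_self (hJ : 0 ≤ J) (hL : 0 ≤ L) (hR : 0 ≤ R) (hh : 0 ≤ h) {r : ℝ} (hr : 0 ≤ r) :
    Phi J L R h r ≤ r := by
  have : Phi J L R h r ≤ ∫ _ in (0 : ℝ)..r, (1 : ℝ) :=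
    intervalIntegral.integral_mono_on hr (continuous_phi.intervalIntegrable _ _) (by simp)
      fun s hs => phi_le_one hJ hL hR hh hs.1
  simpa using this

end Phi

/-! ### The functions `G` and `g_a` -/

section Metric

variable {J K L R h a : ℝ}

lemma G_mono : Monotone (G J L R h a) := fun _ _ hst =>
  lintegral_mono_set (Set.Ioc_subset_Ioc_right hst)

lemma G_zero : G J L R h a 0 = 0 := by simp [G]

lemma cRate_ne_top : cRate J K L R h a ≠ ∞ :=
  ((min_le_left _ _).trans_lt ENNReal.ofReal_lt_top).ne

/-- By monotonicity of `G`, `c` times `G(s)` is at most `G(r₂)⁻¹ G(r₂) / 4`. Working in `[0, ∞]`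
covers `G(r₂) = 0` and `G(r₂) = ∞`, so no smallness of `h` is needed. -/
lemma cRate_mul_G_le {s : ℝ} (hs : s ≤ r2 K R) :
    cRate J K L R h a * G J L R h a s ≤ 4⁻¹ := by
  refine (mul_le_mul' (min_le_right _ _) (G_mono hs)).trans ?_
  rw [mul_assoc]
  exact mul_le_of_le_one_right' (ENNReal.inv_mul_le_one _)

lemma ga_zero : ga J K L R h a 0 = 1 := by simp [ga, G_zero]

lemma ga_mem_Icc {s : ℝ} (hs : s ≤ r2 K R) : ga J K L R h a s ∈ Set.Icc (1 / 2 : ℝ) 1 := by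
  have h1 := ENNReal.toReal_mono (by simp) (cRate_mul_G_le (J := J) (L := L) (h := h) (a := a) hs)
  have h2 : (0 : ℝ) ≤ (cRate J K L R h a * G J L R h a s).toReal := ENNReal.toReal_nonneg
  rw [ENNReal.toReal_inv, ENNReal.toReal_ofNat] at h1
  constructor <;> unfold ga <;> linarith

lemma ga_antitoneOn : AntitoneOn (ga J K L R h a) (Set.Iic (r2 K R)) := by
  intro s _ t ht hst
  have : (cRate J K L R h a * G J L R h a s).toReal ≤ (cRate J K L R h a * G J L R h a t).toReal :=
    ENNReal.toReal_mono ((cRate_mul_G_le ht).trans_lt (by simp)).ne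
      (mul_le_mul' le_rfl (G_mono hst))
  unfold ga
  linarith

/-! ### The function `f_a` -/

/-- The derivative `s ↦ g_a(s ∧ r₂) φ(s ∧ r₂)` of `f_a`. -/
noncomputable def slope (J K L R h a s : ℝ) : ℝ :=
  ga J K L R h a (min s (r2 K R)) * phi J L R h (min s (r2 K R))

lemma slope_nonneg (s : ℝ) : 0 ≤ slope J K L R h a s :=
  mul_nonneg ((by norm_num : (0 : ℝ) ≤ 1 / 2).trans (ga_mem_Icc (min_le_right _ _)).1) (phi_pos _).le

lemma slope_antitoneOn (hJ : 0 ≤ J) (hK : 0 < K) (hL : 0 ≤ L) (hR : 0 ≤ R) (hh : 0 ≤ h) :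
    AntitoneOn (slope J K L R h a) (Set.Ici 0) := by
  intro s hs t ht hst
  have hmin : min s (r2 K R) ≤ min t (r2 K R) := min_le_min hst le_rfl
  have h0 : 0 ≤ r2 K R := hR.trans (lt_r2 hK).le
  have h1 := ga_antitoneOn (J := J) (L := L) (h := h) (a := a)
    (min_le_right s (r2 K R)) (min_le_right t (r2 K R)) hmin
  have h2 := phi_antitoneOn hJ hL hR hh (a := min s (r2 K R)) (b := min t (r2 K R))
    (le_min hs h0) (le_min ht h0) hmin
  have h3 := (ga_mem_Icc (J := J) (L := L) (h := h) (a := a) (min_le_right s (r2 K R))).1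
  exact mul_le_mul h1 h2 (phi_pos _).le (by linarith)

lemma slope_le_phi (s : ℝ) : slope J K L R h a s ≤ phi J L R h (min s (r2 K R)) :=
  mul_le_of_le_one_left (phi_pos _).le (ga_mem_Icc (min_le_right _ _)).2

lemma slope_le_one (hJ : 0 ≤ J) (hK : 0 < K) (hL : 0 ≤ L) (hR : 0 ≤ R) (hh : 0 ≤ h) {s : ℝ}
    (hs : 0 ≤ s) : slope J K L R h a s ≤ 1 :=
  (slope_le_phi s).trans (phi_le_one hJ hL hR hh (le_min hs (hR.trans (lt_r2 hK).le)))

lemma slope_ge (hJ : 0 ≤ J) (hK : 0 < K) (hL : 0 ≤ L) (hR : 0 ≤ R) (hh : 0 ≤ h) {s : ℝ}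
    (hs : 0 ≤ s) : phi J L R h R / 2 ≤ slope J K L R h a s := by
  have h1 := (ga_mem_Icc (J := J) (L := L) (h := h) (a := a) (min_le_right s (r2 K R))).1
  have h2 := phi_R_le hJ hL hR hh (le_min hs (hR.trans (lt_r2 hK (R := R)).le))
  have h3 := phi_pos (J := J) (L := L) (R := R) (h := h) R
  unfold slope
  nlinarith

lemma fa_eq (r : ℝ) : fa J K L R h a r = ∫ s in (0 : ℝ)..r, slope J K L R h a s := rfl

lemma fa_zero : fa J K L R h a 0 = 0 := by simp [fa]

lemma fa_nonneg {r : ℝ} (hr : 0 ≤ r) : 0 ≤ fa J K L R h a r :=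
  intervalIntegral.integral_nonneg hr fun _ _ => slope_nonneg _

section

variable (hJ : 0 ≤ J) (hK : 0 < K) (hL : 0 ≤ L) (hR : 0 ≤ R) (hh : 0 ≤ h)
include hJ hK hL hR hh

lemma fa_monotoneOn : MonotoneOn (fa J K L R h a) (Set.Ici 0) := by
  intro s hs t ht hst
  have hw := slope_antitoneOn (a := a) hJ hK hL hR hh
  have h1 := intervalIntegral.integral_add_adjacent_intervals
    (intervalIntegrable_of_antitoneOn_Ici hw le_rfl hs)
    (intervalIntegrable_of_antitoneOn_Ici hw hs ht)
  have h2 : 0 ≤ ∫ s in s..t, slope J K L R h a s :=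
    intervalIntegral.integral_nonneg hst fun _ _ => slope_nonneg _
  rw [fa_eq, fa_eq]
  linarith

lemma fa_le_self {r : ℝ} (hr : 0 ≤ r) : fa J K L R h a r ≤ r := by
  have hw := slope_antitoneOn (a := a) hJ hK hL hR hh
  have : fa J K L R h a r ≤ ∫ _ in (0 : ℝ)..r, (1 : ℝ) :=
    intervalIntegral.integral_mono_on hr (intervalIntegrable_of_antitoneOn_Ici hw le_rfl hr)
      (by simp) fun s hs => slope_le_one hJ hK hL hR hh hs.1
  simpa using this

lemma fa_le_Phi {r : ℝ} (hr : 0 ≤ r) (hr2 : r ≤ r2 K R) :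
    fa J K L R h a r ≤ Phi J L R h r := by
  have hw := slope_antitoneOn (a := a) hJ hK hL hR hh
  refine intervalIntegral.integral_mono_on hr (intervalIntegrable_of_antitoneOn_Ici hw le_rfl hr)
    (continuous_phi.intervalIntegrable _ _) fun s hs => ?_
  have := slope_le_phi (J := J) (K := K) (L := L) (R := R) (h := h) (a := a) s
  rwa [min_eq_left (hs.2.trans hr2)] at this

lemma fa_le_tangent {r s : ℝ} (hr : 0 ≤ r) (hs : 0 ≤ s) :
    fa J K L R h a s ≤ fa J K L R h a r + slope J K L R h a r * (s - r) :=
  integral_le_tangent (slope_antitoneOn hJ hK hL hR hh) hr hs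

lemma mul_slope_le_fa {r : ℝ} (hr : 0 ≤ r) : slope J K L R h a r * r ≤ fa J K L R h a r := by
  have := fa_le_tangent (a := a) hJ hK hL hR hh hr le_rfl
  rw [fa_zero] at this
  linarith

end

end Metric

/-! ### The law of the distance after one coupled step -/

/-- The joint law of a standard normal variable and an independent uniform variable. -/
noncomputable abbrev noiseLaw : Measure (ℝ × ℝ) :=
  (gaussianReal 0 1).prod (volume.restrict (Set.Ioo (0 : ℝ) 1))

instance : IsProbabilityMeasure (volume.restrict (Set.Ioo (0 : ℝ) 1)) :=
  ⟨by simp⟩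

/-- Likelihood ratio of two unit normal distributions whose means differ by `q`. -/
noncomputable def ratio (q n : ℝ) : ℝ := Real.exp (-(q ^ 2 / 2 + q * n))

open Classical in
/-- The distance after a coupled step from distance `q`, for unit noise `p.1` in the direction of
reflection and uniform variable `p.2`. -/
noncomputable def gap (q : ℝ) (p : ℝ × ℝ) : ℝ :=
  if p.2 ≤ ratio q p.1 then 0 else |q + 2 * p.1|

lemma measurable_ratio (q : ℝ) : Measurable (ratio q) := by
  unfold ratio
  fun_prop

lemma measurableSet_le_ratio (q : ℝ) : MeasurableSet {p : ℝ × ℝ | p.2 ≤ ratio q p.1} :=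
  measurableSet_le measurable_snd ((measurable_ratio q).comp measurable_fst)

lemma measurable_gap (q : ℝ) : Measurable (gap q) := by
  unfold gap
  exact Measurable.ite (measurableSet_le_ratio q) measurable_const (by fun_prop)

lemma gap_nonneg (q : ℝ) (p : ℝ × ℝ) : 0 ≤ gap q p := by
  unfold gap
  split_ifs <;> positivity

lemma integrable_id_gaussianReal : Integrable (fun n : ℝ => n) (gaussianReal 0 1) :=
  (memLp_id_gaussianReal 1).integrable le_rfl

lemma integrable_gap (q : ℝ) : Integrable (gap q) noiseLaw := by
  have h1 : Integrable (fun n : ℝ => |q + 2 * n|) (gaussianReal 0 1) :=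
    ((integrable_const q).add (integrable_id_gaussianReal.const_mul 2)).abs
  have h2 : Integrable (fun p : ℝ × ℝ => |q + 2 * p.1|) noiseLaw := h1.comp_fst _
  refine h2.mono (measurable_gap q).aestronglyMeasurable (Filter.Eventually.of_forall fun p => ?_)
  unfold gap
  split_ifs <;> simp

open Classical in
-- Integrating out the uniform variable leaves the probability of not merging given `n`, which is
-- the positive part of `1 - ratio q n`.
lemma integral_ite_le_ratio (q : ℝ) {F : ℝ → ℝ}
    (hF : Integrable (fun p : ℝ × ℝ => if p.2 ≤ ratio q p.1 then 0 else F p.1) noiseLaw) :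
    ∫ p, (if p.2 ≤ ratio q p.1 then 0 else F p.1) ∂noiseLaw =
      ∫ n, F n * max (1 - ratio q n) 0 ∂gaussianReal 0 1 := by
  rw [integral_prod _ hF]
  congr 1
  ext n
  have he : 0 ≤ ratio q n := (Real.exp_pos _).le
  have h1 : (fun u : ℝ => if u ≤ ratio q n then 0 else F n) =
      (Set.Ioi (ratio q n)).indicator fun _ => F n := by
    ext u
    by_cases hu : u ≤ ratio q n
    · simp [hu]
    · simp [hu, not_le.1 hu]
  have h2 : Set.Ioi (ratio q n) ∩ Set.Ioo 0 1 = Set.Ioo (ratio q n) 1 := by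
    ext u
    simp only [Set.mem_inter_iff, Set.mem_Ioi, Set.mem_Ioo]
    exact ⟨fun h => ⟨h.1, h.2.2⟩, fun h => ⟨h.1, he.trans_lt h.1, h.2⟩⟩
  simp only [h1]
  rw [integral_indicator measurableSet_Ioi, setIntegral_const, measureReal_def,
    Measure.restrict_apply measurableSet_Ioi, h2, Real.volume_Ioo, ENNReal.toReal_ofReal',
    smul_eq_mul, mul_comm]

lemma gaussianPDFReal_add_eq (q n : ℝ) :
    gaussianPDFReal 0 1 (-q - n) = gaussianPDFReal 0 1 n * ratio q n := by
  unfold gaussianPDFReal ratio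
  rw [mul_assoc _⁻¹, ← Real.exp_add]
  congr 2
  simp
  ring

/-- The reflection `n ↦ -q - n` multiplies the Gaussian density by the ratio and inverts the ratio,
so it preserves density times `min 1 ratio` and flips the sign of `q + 2n`. -/
lemma integral_antisymm_part (q : ℝ) :
    ∫ n, (q + 2 * n) * min 1 (ratio q n) ∂gaussianReal 0 1 = 0 := by
  rw [integral_gaussianReal_eq_integral_smul (by simp)]
  set k : ℝ → ℝ := fun n => gaussianPDFReal 0 1 n • ((q + 2 * n) * min 1 (ratio q n)) with hk
  have h1 : ∀ n, k (-q - n) = -k n := by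
    intro n
    have hpos : 0 < ratio q n := Real.exp_pos _
    have h2 : ratio q (-q - n) = (ratio q n)⁻¹ := by
      unfold ratio
      rw [← Real.exp_neg]
      congr 1
      ring
    have h3 : ratio q n * min 1 (ratio q n)⁻¹ = min 1 (ratio q n) := by
      rw [mul_min_of_nonneg _ _ hpos.le, mul_inv_cancel₀ hpos.ne', mul_one, min_comm]
    simp only [hk, smul_eq_mul, gaussianPDFReal_add_eq, h2]
    rw [← h3]
    ring
  have h4 := integral_sub_left_eq_self k volume (-q)
  simp only [h1, integral_neg] at h4
  linarith

lemma abs_mul_max_eq {q : ℝ} (hq : 0 < q) (n : ℝ) :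
    |q + 2 * n| * max (1 - ratio q n) 0 = (q + 2 * n) - (q + 2 * n) * min 1 (ratio q n) := by
  rcases le_total 1 (ratio q n) with h | h
  · simp [h]
  -- The ratio is at most 1 exactly when `q (q + 2n) ≥ 0`, so the absolute value is inactive
  -- wherever reflection can occur.
  · have h1 : 0 ≤ q + 2 * n := by
      unfold ratio at h
      rw [Real.exp_le_one_iff] at h
      by_contra! hc
      nlinarith
    rw [abs_of_nonneg h1, max_eq_left (by linarith), min_eq_right h]
    ring

/-- The mean distance after a coupled step is the distance before it. -/
lemma integral_gap {q : ℝ} (hq : 0 < q) : ∫ p, gap q p ∂noiseLaw = q := by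
  have h1 : Integrable (fun n : ℝ => q + 2 * n) (gaussianReal 0 1) :=
    (integrable_const q).add (integrable_id_gaussianReal.const_mul 2)
  have h2 : Integrable (fun n : ℝ => (q + 2 * n) * min 1 (ratio q n)) (gaussianReal 0 1) := by
    refine h1.mono (Measurable.aestronglyMeasurable ?_) (Filter.Eventually.of_forall fun n => ?_)
    · have := measurable_ratio q
      fun_prop
    · have : 0 ≤ ratio q n := (Real.exp_pos _).le
      rw [norm_mul]
      refine mul_le_of_le_one_right (norm_nonneg _) ?_
      rw [Real.norm_of_nonneg (by positivity)]
      exact min_le_left _ _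
  unfold gap
  rw [integral_ite_le_ratio q (F := fun n => |q + 2 * n|) (integrable_gap q)]
  simp only [abs_mul_max_eq hq]
  rw [integral_sub h1 h2, integral_antisymm_part, integral_add (integrable_const _)
    (integrable_id_gaussianReal.const_mul 2), integral_const_mul, integral_id_gaussianReal]
  simp

lemma ae_noiseLaw_snd_lt : ∀ᵐ p ∂noiseLaw, p.2 < 1 := by
  have h : ∀ᵐ u ∂(volume.restrict (Set.Ioo (0 : ℝ) 1)), u < 1 := by
    filter_upwards [ae_restrict_mem measurableSet_Ioo] with u hu using hu.2
  exact Measure.quasiMeasurePreserving_snd.ae h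

lemma gaussianReal_Iio_neg_one : (gaussianReal 0 1).real (Set.Iio (-1)) = p0 := by
  have h : (gaussianReal 0 1).map (fun x => -x) = gaussianReal 0 1 := by
    rw [gaussianReal_map_neg, neg_zero]
  rw [p0_eq_gaussianReal, ← h, map_measureReal_apply measurable_neg measurableSet_Ioi, h]
  congr 1
  ext x
  simp [lt_neg]

open Classical in
/-- From distance at most `2`, the step merges with probability at least `p₀`. -/
lemma integral_gap_ne_zero_le {q : ℝ} (hq : 0 < q) (hq2 : q ≤ 2) :
    ∫ p, (if gap q p ≠ 0 then 1 else 0 : ℝ) ∂noiseLaw ≤ 1 - p0 := by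
  have h1 : Integrable (fun n : ℝ => (Set.Iio (-1 : ℝ))ᶜ.indicator (fun _ => (1 : ℝ)) n)
      (gaussianReal 0 1) := (integrable_const 1).indicator measurableSet_Iio.compl
  have h2 : ∫ p : ℝ × ℝ, (Set.Iio (-1 : ℝ))ᶜ.indicator (fun _ => (1 : ℝ)) p.1 ∂noiseLaw
      = 1 - p0 := by
    rw [integral_fun_fst (fun n => (Set.Iio (-1 : ℝ))ᶜ.indicator (fun _ => (1 : ℝ)) n),
      integral_indicator measurableSet_Iio.compl, setIntegral_const,
      probReal_compl_eq_one_sub measurableSet_Iio, gaussianReal_Iio_neg_one]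
    simp
  rw [← h2]
  refine integral_mono_of_nonneg (Filter.Eventually.of_forall fun p => ?_) (h1.comp_fst _) ?_
  · dsimp only
    split_ifs <;> simp
  · filter_upwards [ae_noiseLaw_snd_lt] with p hp
    by_cases hn : p.1 < -1
    · have : gap q p = 0 := by
        refine if_pos (hp.le.trans ?_)
        -- With `n < -1` and `0 < q ≤ 2`, `q (q/2 + n) < 0`: the ratio is at least 1 and merging is
        -- certain.
        refine Real.one_le_exp ?_
        nlinarith
      simp [this, hn]
    · have : p.1 ∈ (Set.Iio (-1 : ℝ))ᶜ := hn
      rw [Set.indicator_of_mem this]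
      split_ifs <;> norm_num

/-- Bernoulli's inequality for `(exp (-B)) ^ k`. -/
lemma one_sub_exp_le_mul {A B : ℝ} {k : ℝ} (hk : 1 ≤ k) (hA : 0 ≤ A) (hAB : A ≤ k * B) :
    1 - Real.exp (-A) ≤ k * (1 - Real.exp (-B)) := by
  have h1 : Real.exp (-(k * B)) ≤ Real.exp (-A) := Real.exp_le_exp.2 (by linarith)
  have hB : 0 ≤ B := by
    by_contra! h
    nlinarith
  have h2 := one_add_mul_self_le_rpow_one_add (s := Real.exp (-B) - 1)
    (by linarith [Real.exp_pos (-B)]) hk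
  have h3 : (1 + (Real.exp (-B) - 1)) ^ k = Real.exp (-(k * B)) := by
    rw [add_sub_cancel, ← Real.exp_mul]
    congr 1
    ring
  rw [h3] at h2
  linarith

/-- For `q ≥ 1` the exponent `q²/2 + qn` is at least its value at `q = 1`, and the deviation is at
least 3/8 in size. For `q ≤ 1` the reflection probability may be smaller, but `q < x` makes the
deviation at least `2|n|`; the Bernoulli bound with `k = 32n²` trades one for the other. -/
lemma one_sub_exp_le_of_noise {q x n : ℝ} (hx : 1 < x) (hqx : |q - x| ≤ 1 / 8)
    (hn : n ∈ Set.Icc (-(3 / 8) : ℝ) (-(1 / 4))) :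
    1 / 8 * (1 - Real.exp (-n - 1 / 2)) ≤ (q + 2 * n - x) ^ 2 * (1 - ratio q n) := by
  obtain ⟨h1, h2⟩ := abs_le.1 hqx
  obtain ⟨h3, h4⟩ := hn
  have hA : Real.exp (-n - 1 / 2) = Real.exp (-(1 / 2 + n)) := by
    congr 1
    ring
  rw [hA, ratio]
  rcases le_total 1 q with hq | hq
  · have h5 : 1 - Real.exp (-(1 / 2 + n)) ≤ 1 - Real.exp (-(q ^ 2 / 2 + q * n)) := by
      have : Real.exp (-(q ^ 2 / 2 + q * n)) ≤ Real.exp (-(1 / 2 + n)) := by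
        apply Real.exp_le_exp.2
        nlinarith
      linarith
    have h6 : 0 ≤ 1 - Real.exp (-(1 / 2 + n)) := by
      have : Real.exp (-(1 / 2 + n)) ≤ 1 := Real.exp_le_one_iff.2 (by linarith)
      linarith
    have h7 : 1 / 8 ≤ (q + 2 * n - x) ^ 2 := by nlinarith
    exact mul_le_mul h7 h5 h6 (by positivity)
  · have hB : 49 / 128 + 7 / 8 * n ≤ q ^ 2 / 2 + q * n := by nlinarith
    have hk : 2 ≤ 32 * n ^ 2 := by nlinarith
    -- The left side is the tangent of `32n²` at `n = -1/4`.
    have hk2 : -16 * n - 2 ≤ 32 * n ^ 2 := by nlinarith [sq_nonneg (n + 1 / 4)]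
    have hAB : 1 / 2 + n ≤ 32 * n ^ 2 * (q ^ 2 / 2 + q * n) := by
      calc 1 / 2 + n ≤ (-16 * n - 2) * (49 / 128 + 7 / 8 * n) := by nlinarith
        _ ≤ 32 * n ^ 2 * (q ^ 2 / 2 + q * n) :=
          mul_le_mul hk2 hB (by linarith) (by positivity)
    have h5 := one_sub_exp_le_mul (by linarith) (by linarith) hAB
    have h6 : 4 * n ^ 2 ≤ (q + 2 * n - x) ^ 2 := by nlinarith
    have h7 : 0 ≤ 1 - Real.exp (-(q ^ 2 / 2 + q * n)) := by
      have : Real.exp (-(q ^ 2 / 2 + q * n)) ≤ 1 := Real.exp_le_one_iff.2 (by linarith)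
      linarith
    nlinarith

lemma c0t_eq_setIntegral : 2 * c0t = ∫ n in Set.Icc (-(3 / 8) : ℝ) (-(1 / 4)),
    gaussianPDFReal 0 1 n * (1 / 8 * (1 - Real.exp (-n - 1 / 2))) := by
  have h1 := intervalIntegral.integral_comp_neg (a := 1 / 4) (b := 3 / 8)
    (fun n => gaussianPDFReal 0 1 n * (1 / 8 * (1 - Real.exp (-n - 1 / 2))))
  rw [integral_Icc_eq_integral_Ioc, ← intervalIntegral.integral_of_le (by norm_num), ← h1, c0t,
    ← mul_assoc, ← intervalIntegral.integral_const_mul]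
  congr 1
  ext u
  have h2 : gaussianPDFReal 0 1 (-u) = gaussianPDFReal 0 1 u := by simp [gaussianPDFReal]
  rw [h2, neg_neg]
  ring

/-- Squared deviation from `x`, cut off outside `(x - 1, x)`. -/
noncomputable def cutSq (x : ℝ) : ℝ → ℝ := (Set.Ioo (x - 1) x).indicator fun s => (s - x) ^ 2

lemma measurable_cutSq (x : ℝ) : Measurable (cutSq x) :=
  Measurable.indicator (by fun_prop) measurableSet_Ioo

lemma cutSq_nonneg (x s : ℝ) : 0 ≤ cutSq x s :=
  Set.indicator_nonneg (fun _ _ => sq_nonneg _) _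

lemma cutSq_le_one (x s : ℝ) : cutSq x s ≤ 1 := by
  unfold cutSq
  refine Set.indicator_le' (fun s hs => ?_) (fun _ _ => zero_le_one) s
  nlinarith [hs.1, hs.2]

lemma integrable_cutSq_gap (x q : ℝ) : Integrable (fun p => cutSq x (gap q p)) noiseLaw := by
  refine Integrable.of_bound ((measurable_cutSq x).comp (measurable_gap q)).aestronglyMeasurable 1
    (Filter.Eventually.of_forall fun p => ?_)
  rw [Real.norm_of_nonneg (cutSq_nonneg _ _)]
  exact cutSq_le_one _ _

/-- The distance after a coupled step fluctuates to the left of the distance before it. -/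
lemma le_integral_cutSq_gap {q x : ℝ} (hx : 1 < x) (hqx : |q - x| ≤ 1 / 8) :
    2 * c0t ≤ ∫ p, cutSq x (gap q p) ∂noiseLaw := by
  classical
  have h0 : ∀ p, cutSq x (gap q p) =
      if p.2 ≤ ratio q p.1 then 0 else cutSq x |q + 2 * p.1| := by
    intro p
    unfold gap
    split_ifs
    -- Merged paths contribute nothing: `x > 1` keeps 0 outside the window `(x - 1, x)`.
    · refine Set.indicator_of_notMem (fun h => ?_) _
      linarith [h.1]
    · rfl
  have hint := integrable_cutSq_gap x q
  simp only [h0] at hint ⊢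
  rw [integral_ite_le_ratio q (F := fun n => cutSq x |q + 2 * n|) hint,
    integral_gaussianReal_eq_integral_smul (by simp), c0t_eq_setIntegral,
    ← integral_indicator measurableSet_Icc]
  have hpdf : Integrable (fun n => gaussianPDFReal 0 1 n) := integrable_gaussianPDFReal 0 1
  refine integral_mono ?_ ?_ fun n => ?_
  · refine IntegrableOn.integrable_indicator ?_ measurableSet_Icc
    refine Continuous.integrableOn_Icc ?_
    unfold gaussianPDFReal
    fun_prop
  · refine hpdf.mul_bdd (c := 1) ?_ (Filter.Eventually.of_forall fun n => ?_)
    · have := measurable_ratio q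
      have := measurable_cutSq x
      refine Measurable.aestronglyMeasurable ?_
      fun_prop
    · have h1 : 0 ≤ ratio q n := (Real.exp_pos _).le
      have h2 : max (1 - ratio q n) 0 ≤ 1 := max_le (by linarith) zero_le_one
      rw [Real.norm_of_nonneg (mul_nonneg (cutSq_nonneg _ _) (le_max_right _ _))]
      exact mul_le_one₀ (cutSq_le_one _ _) (le_max_right _ _) h2
  · have hpos := gaussianPDFReal_nonneg 0 1 n
    by_cases hn : n ∈ Set.Icc (-(3 / 8) : ℝ) (-(1 / 4))
    · rw [Set.indicator_of_mem hn, smul_eq_mul]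
      refine mul_le_mul_of_nonneg_left ?_ hpos
      obtain ⟨h1, h2⟩ := abs_le.1 hqx
      have h3 : 0 ≤ q + 2 * n := by linarith [hn.1]
      have h4 : q + 2 * n ∈ Set.Ioo (x - 1) x := ⟨by linarith [hn.1], by linarith [hn.2]⟩
      rw [abs_of_nonneg h3, cutSq, Set.indicator_of_mem h4]
      refine (one_sub_exp_le_of_noise hx hqx hn).trans ?_
      exact mul_le_mul_of_nonneg_left (le_max_left _ _) (sq_nonneg _)
    · rw [Set.indicator_of_notMem hn]
      exact mul_nonneg hpos (mul_nonneg (cutSq_nonneg _ _) (le_max_right _ _))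

/-! ### Reduction to one dimension -/

section Geometry

variable {d : ℕ} {b : EuclideanSpace ℝ (Fin d) → EuclideanSpace ℝ (Fin d)} {h : ℝ}

lemma norm_unitDir {u v : EuclideanSpace ℝ (Fin d)} (huv : u ≠ v) : ‖unitDir u v‖ = 1 := by
  have : ‖u - v‖ ≠ 0 := norm_ne_zero_iff.2 (sub_ne_zero.2 huv)
  rw [unitDir, norm_smul, norm_inv, norm_norm, inv_mul_cancel₀ this]

lemma norm_smul_unitDir (u v : EuclideanSpace ℝ (Fin d)) : ‖u - v‖ • unitDir u v = u - v := by
  rcases eq_or_ne u v with rfl | huv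
  · simp
  · have : ‖u - v‖ ≠ 0 := norm_ne_zero_iff.2 (sub_ne_zero.2 huv)
    rw [unitDir, smul_smul, mul_inv_cancel₀ this, one_smul]

lemma hasLaw_inner_stdGaussian {e : EuclideanSpace ℝ (Fin d)} (he : ‖e‖ = 1) :
    HasLaw (fun z => inner ℝ e z) (gaussianReal 0 1) (stdGaussian (EuclideanSpace ℝ (Fin d))) := by
  refine ⟨by fun_prop, ?_⟩
  have h1 := IsGaussian.map_eq_gaussianReal (μ := stdGaussian (EuclideanSpace ℝ (Fin d)))
    (innerSL ℝ e)
  rw [integral_strongDual_stdGaussian, variance_dual_stdGaussian, innerSL_apply_norm, he] at h1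
  simpa using h1

lemma gaussDensity_div (hh : 0 < h) {u v z : EuclideanSpace ℝ (Fin d)} :
    gaussDensity h v (u + √h • z) / gaussDensity h u (u + √h • z) =
      ratio (‖u - v‖ / √h) (inner ℝ (unitDir u v) z) := by
  have hs : 0 < √h := Real.sqrt_pos.2 hh
  have hc : (2 * Real.pi * h) ^ (-((d : ℝ) / 2)) ≠ 0 := (Real.rpow_pos_of_pos (by positivity) _).ne'
  unfold gaussDensity ratio
  rw [mul_div_mul_left _ _ hc, ← Real.exp_sub]
  congr 1
  have h1 : u + √h • z - v = (u - v) + √h • z := by abel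
  have h2 : inner ℝ (u - v) z = ‖u - v‖ * inner ℝ (unitDir u v) z := by
    rw [← real_inner_smul_left, norm_smul_unitDir]
  rw [h1, norm_add_sq_real, add_sub_cancel_left, inner_smul_right, h2, div_pow, Real.sq_sqrt hh.le]
  field_simp
  linear_combination (-2 * ‖u - v‖ * inner ℝ (unitDir u v) z) * Real.sq_sqrt hh.le

/-- The distance after a coupled step depends only on the noise in the direction of reflection. -/
lemma norm_stepX_sub_stepY (hh : 0 < h) {x y : EuclideanSpace ℝ (Fin d)}
    (hxy : drift b h x ≠ drift b h y) (z : EuclideanSpace ℝ (Fin d)) (u : ℝ) :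
    ‖stepX b h x z - stepY b h x y z u‖ = √h * gap (‖drift b h x - drift b h y‖ / √h)
      (inner ℝ (unitDir (drift b h x) (drift b h y)) z, u) := by
  have hs : 0 < √h := Real.sqrt_pos.2 hh
  unfold stepY gap
  simp only [stepX, gaussDensity_div hh]
  split_ifs
  · simp
  · have h1 : drift b h x + √h • z - stepRefl b h x y z = (√h * (‖drift b h x - drift b h y‖ / √h
        + 2 * inner ℝ (unitDir (drift b h x) (drift b h y)) z)) •
          unitDir (drift b h x) (drift b h y) := by
      rw [mul_add, mul_div_cancel₀ _ hs.ne', add_smul, norm_smul_unitDir, stepRefl, smul_sub,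
        smul_smul]
      abel
    rw [h1, norm_smul, norm_unitDir hxy, mul_one, norm_mul, Real.norm_of_nonneg hs.le,
      Real.norm_eq_abs]

lemma stepX_eq_stepY (hh : 0 < h) (x z : EuclideanSpace ℝ (Fin d)) {u : ℝ} (hu : u ≤ 1) :
    stepY b h x x z u = stepX b h x z := by
  unfold stepY
  refine if_pos ?_
  rw [div_self]
  · exact hu
  · unfold gaussDensity
    positivity

/-! ### Deterministic part of the step -/

variable {J K L R : ℝ} {x y : EuclideanSpace ℝ (Fin d)}

lemma drift_sub (b : EuclideanSpace ℝ (Fin d) → EuclideanSpace ℝ (Fin d)) (h : ℝ)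
    (x y : EuclideanSpace ℝ (Fin d)) :
    drift b h x - drift b h y = (x - y) + h • (b x - b y) := by
  simp only [drift, smul_sub]
  abel

lemma norm_drift_sub_sq (b : EuclideanSpace ℝ (Fin d) → EuclideanSpace ℝ (Fin d)) (h : ℝ)
    (x y : EuclideanSpace ℝ (Fin d)) :
    ‖drift b h x - drift b h y‖ ^ 2 =
      ‖x - y‖ ^ 2 + 2 * h * inner ℝ (x - y) (b x - b y) + h ^ 2 * ‖b x - b y‖ ^ 2 := by
  rw [drift_sub, norm_add_sq_real, inner_smul_right, norm_smul, mul_pow, Real.norm_eq_abs, sq_abs]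
  ring

lemma abs_norm_drift_sub_le (hh : 0 ≤ h) (hC3 : ‖b x - b y‖ ≤ L * ‖x - y‖) :
    |‖drift b h x - drift b h y‖ - ‖x - y‖| ≤ h * L * ‖x - y‖ := by
  refine (abs_norm_sub_norm_le _ _).trans ?_
  rw [drift_sub, add_sub_cancel_left, norm_smul, Real.norm_of_nonneg hh, mul_assoc]
  gcongr

/-- The bound by `L` is the triangle inequality. The other comes from the squared norm: `1 + 2hJ +
h²L² ≤ (1 + h(J + L²h/2))²`. -/
lemma norm_drift_sub_le_Lam (hh : 0 ≤ h) (hJ : 0 ≤ J)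
    (hC1 : inner ℝ (x - y) (b x - b y) ≤ J * ‖x - y‖ ^ 2) (hC3 : ‖b x - b y‖ ≤ L * ‖x - y‖) :
    ‖drift b h x - drift b h y‖ ≤ ‖x - y‖ + h * Lam J L h * ‖x - y‖ := by
  have hr := norm_nonneg (x - y)
  unfold Lam
  rcases min_choice L (J + L ^ 2 * h / 2) with hm | hm <;> rw [hm]
  · linarith [(abs_le.1 (abs_norm_drift_sub_le hh hC3)).2]
  · refine abs_le_of_sq_le_sq' ?_ (by positivity) |>.2
    rw [norm_drift_sub_sq]
    have h1 : ‖b x - b y‖ ^ 2 ≤ (L * ‖x - y‖) ^ 2 := by gcongr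
    have h2 : h ^ 2 * ‖b x - b y‖ ^ 2 ≤ h ^ 2 * (L * ‖x - y‖) ^ 2 := by gcongr
    have h3 : h * inner ℝ (x - y) (b x - b y) ≤ h * (J * ‖x - y‖ ^ 2) := by gcongr
    nlinarith [sq_nonneg (h * (J + L ^ 2 * h / 2) * ‖x - y‖)]

lemma norm_drift_sub_le_of_le (hh : 0 ≤ h) (hxy : 0 < ‖x - y‖) (hhK : h * L ^ 2 ≤ K)
    (hC2 : inner ℝ (x - y) (b x - b y) ≤ -K * ‖x - y‖ ^ 2) (hC3 : ‖b x - b y‖ ≤ L * ‖x - y‖) :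
    ‖drift b h x - drift b h y‖ ≤ ‖x - y‖ - h * K / 2 * ‖x - y‖ := by
  have h1 : ‖b x - b y‖ ^ 2 ≤ (L * ‖x - y‖) ^ 2 := by gcongr
  have h2 : h ^ 2 * ‖b x - b y‖ ^ 2 ≤ h ^ 2 * (L * ‖x - y‖) ^ 2 := by gcongr
  have h3 : h * inner ℝ (x - y) (b x - b y) ≤ h * (-K * ‖x - y‖ ^ 2) := by gcongr
  have h4 : h * ‖x - y‖ ^ 2 * (h * L ^ 2) ≤ h * ‖x - y‖ ^ 2 * K := by gcongr
  have h5 : ‖drift b h x - drift b h y‖ ^ 2 ≤ (1 - h * K) * ‖x - y‖ ^ 2 := by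
    rw [norm_drift_sub_sq]
    nlinarith
  -- A negative factor would contradict `h5`, whose left side is a square.
  have h6 : 0 ≤ 1 - h * K := by
    by_contra! hc
    nlinarith [sq_nonneg ‖drift b h x - drift b h y‖, pow_pos hxy 2]
  refine abs_le_of_sq_le_sq' ?_ (by nlinarith) |>.2
  nlinarith [sq_nonneg (h * K * ‖x - y‖)]

end Geometry

/-! ### Bounds for `G` and for the rate -/

section Rate

variable {J K L R h a : ℝ}

lemma h0_spec (hK : 0 < K) (hL : 0 < L) (hR : 0 < R) (hh : 0 < h) (hlt : h < h0 K L R) :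
    h * L < p0 / 2 ∧ h * L ^ 2 < K ∧ L * √h * r2 K R < 1 / 8 := by
  have hr2 : 0 < r2 K R := hR.trans (lt_r2 hK)
  unfold h0 at hlt
  rw [one_div, ← div_eq_inv_mul, lt_div_iff₀ hL, lt_min_iff, lt_min_iff, lt_div_iff₀ hL]
    at hlt
  obtain ⟨h1, h2, h3⟩ := hlt
  rw [lt_div_iff₀ (by positivity)] at h3
  refine ⟨by linarith, by linarith, ?_⟩
  refine lt_of_pow_lt_pow_left₀ 2 (by norm_num) ?_
  rw [mul_pow, mul_pow, Real.sq_sqrt hh.le]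
  linarith

lemma alphaLow_of_mem (hL : 0 < L) (hh : 0 < h) {u : ℝ} (h1 : √h ≤ u) (h2 : L * √h * u ≤ 1 / 4) :
    alphaLow L h u = c0t * h := by
  have hs : 0 < √h := Real.sqrt_pos.2 hh
  refine if_pos ⟨h1, ?_⟩
  rw [le_div_iff₀ (by positivity)]
  linarith

/-- The dual interval is designed for this: for `s` in `(t, r)` it contains `r`, so the supremum in
`G` dominates its value at the fixed point `r`. -/
lemma le_G (hL : 0 < L) (hh : 0 < h) (hJ : 0 ≤ J) (hR : 0 ≤ R) {t r : ℝ} (ht : 0 ≤ t)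
    (htr : t ≤ r) (hrt : r - √h ≤ t) (hr : √h < r) (hLr : L * √h * r ≤ 1 / 4) :
    G J L R h a t + ENNReal.ofReal ((r - t) * (1 / phi J L R h t * ((a + Phi J L R h r) /
      (c0t * h)))) ≤ G J L R h a r := by
  have hc := c0t_pos
  have hP := Phi_nonneg (J := J) (L := L) (R := R) (h := h) (ht.trans htr)
  have h1 : G J L R h a r = G J L R h a t + ∫⁻ s in Set.Ioc t r,
      ENNReal.ofReal (1 / phi J L R h s) * ⨆ u ∈ dualInterval h s,
        ENNReal.ofReal (a + Phi J L R h u) / ENNReal.ofReal (alphaLow L h u) := by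
    unfold G
    rw [← lintegral_union measurableSet_Ioc (Set.Ioc_disjoint_Ioc_of_le le_rfl),
      Set.Ioc_union_Ioc_eq_Ioc ht htr]
  rw [h1]
  gcongr
  rw [ENNReal.ofReal_mul (by linarith), mul_comm, ← Real.volume_Ioo, ← setLIntegral_const]
  refine (setLIntegral_mono_ae' measurableSet_Ioo (Filter.Eventually.of_forall
    fun s hs => ?_)).trans (lintegral_mono_set Set.Ioo_subset_Ioc_self)
  have hphi : phi J L R h s ≤ phi J L R h t :=
    phi_antitoneOn hJ hL.le hR hh.le ht (ht.trans hs.1.le) hs.1.le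
  have hpos := phi_pos (J := J) (L := L) (R := R) (h := h) s
  have hmem : r ∈ dualInterval h s := ⟨⟨hs.2, by linarith [hs.1]⟩, hr⟩
  have hpost := phi_pos (J := J) (L := L) (R := R) (h := h) t
  rw [ENNReal.ofReal_mul (by positivity)]
  gcongr
  refine le_trans (le_of_eq ?_) (le_iSup₂ (f := fun u (_ : u ∈ dualInterval h s) =>
    ENNReal.ofReal (a + Phi J L R h u) / ENNReal.ofReal (alphaLow L h u)) r hmem)
  rw [alphaLow_of_mem hL hh hr.le hLr, ENNReal.ofReal_div_of_pos (by positivity)]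

lemma G_r2_le (hJ : 0 ≤ J) (hL : 0 < L) (hR : 0 < R) (hh : 0 < h) (ha : 0 ≤ a)
    (hhr : √h < r2 K R) (hLr : L * √h * r2 K R < 1 / 8) :
    G J L R h a (r2 K R) ≤ ENNReal.ofReal
      (r2 K R * (r2 K R + 2 * (a + √h)) / (2 * (c0t * h * phi J L R h R))) := by
  have hc := c0t_pos
  have hs : 0 < √h := Real.sqrt_pos.2 hh
  have hphi := phi_pos (J := J) (L := L) (R := R) (h := h) R
  have hr2 : 0 < r2 K R := hs.trans hhr
  set B : ℝ → ℝ := fun s => (a + (s + √h)) / (c0t * h * phi J L R h R) with hB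
  have hBc : Continuous B := by fun_prop
  have h1 : ∫ s in (0 : ℝ)..r2 K R, B s =
      r2 K R * (r2 K R + 2 * (a + √h)) / (2 * (c0t * h * phi J L R h R)) := by
    simp only [hB]
    rw [intervalIntegral.integral_div, intervalIntegral.integral_add (by simp)
      (Continuous.intervalIntegrable (by fun_prop) _ _), intervalIntegral.integral_add
      (Continuous.intervalIntegrable (by fun_prop) _ _) (by simp)]
    simp
    field_simp
    ring
  rw [← h1, intervalIntegral.integral_of_le hr2.le, ofReal_integral_eq_lintegral_ofReal
    (hBc.integrableOn_Ioc) ((ae_restrict_mem measurableSet_Ioc).mono fun s hs => ?_)]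
  · refine setLIntegral_mono_ae' measurableSet_Ioc (Filter.Eventually.of_forall fun s hs => ?_)
    have hs0 : 0 < s := hs.1
    have hBs : B s = 1 / phi J L R h R * ((a + (s + √h)) / (c0t * h)) := by
      simp only [hB]
      field_simp
    rw [hBs, ENNReal.ofReal_mul (by positivity)]
    have hphis := phi_R_le hJ hL.le hR.le hh.le hs.1.le
    gcongr
    refine iSup₂_le fun u hu => ?_
    obtain ⟨⟨hu1, hu2⟩, hu3⟩ := hu
    rw [Set.mem_Ioi] at hu3
    -- Here `u < s + √h ≤ 2 r₂`; the 1/8 in the step-size condition leaves room for this factor 2.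
    have hLu : L * √h * u ≤ 1 / 4 := by
      have : L * √h * u ≤ L * √h * (2 * r2 K R) := by
        gcongr
        linarith [hs.2]
      linarith
    rw [alphaLow_of_mem hL hh hu3.le hLu, ← ENNReal.ofReal_div_of_pos (by positivity)]
    apply ENNReal.ofReal_le_ofReal
    have := Phi_le_self hJ hL.le hR.le hh.le (hs0.trans hu1).le
    gcongr
    linarith
  · have : 0 < s := hs.1
    simp only [Pi.zero_apply, hB]
    positivity

lemma c2_nonneg (hK : 0 < K) (hR : 0 < R) (hh : 0 < h) (ha : 0 ≤ a) : 0 ≤ c2 J K L R h a := by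
  have hc := c0t_pos
  have hp := p0_pos
  have hphi := phi_pos (J := J) (L := L) (R := R) (h := h) R
  unfold c2
  positivity

lemma c2_mul_le (hh : 0 < h) : c2 J K L R h a * h ≤ p0 / 2 := by
  have h1 : c2 J K L R h a ≤ 1 / 8 * (4 * p0 / h) := by
    unfold c2
    gcongr
    exact (min_le_right _ _).trans (min_le_right _ _)
  calc c2 J K L R h a * h ≤ 1 / 8 * (4 * p0 / h) * h := by gcongr
    _ = p0 / 2 := by
      field_simp
      ring

lemma c2_le_div (hK : 0 < K) (hR : 0 < R) (ha : 0 ≤ a) :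
    c2 J K L R h a ≤ c0t * phi J L R h R / (r2 K R * (r2 K R + 2 * (a + √h))) := by
  have hc := c0t_pos
  have hphi := phi_pos (J := J) (L := L) (R := R) (h := h) R
  set F := phi J L R h R with hF
  set β := a + √h with hβ
  have hβ0 : 0 ≤ β := by positivity
  obtain ⟨w, hw⟩ : ∃ w, w = √(2 * c0t / K) := ⟨_, rfl⟩
  have hw0 : 0 < w := hw ▸ Real.sqrt_pos.2 (by positivity)
  have hw2 : w ^ 2 = 2 * c0t / K := by rw [hw, Real.sq_sqrt (by positivity)]
  have hKw : K = 2 * c0t / w ^ 2 := by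
    rw [hw2]
    field_simp
  have hsq : √(2 * K / c0t) = 2 / w := by
    rw [Real.sqrt_eq_iff_mul_self_eq (by positivity) (by positivity), hKw]
    field_simp
  have hr2 : r2 K R = R + w := by rw [r2, hw]
  unfold c2
  rw [hr2, ← hβ, ← hF, hsq]
  -- As `r₂ = R + w`, the larger of `R` and `w` is at least `r₂ / 2`, and selects the term of the
  -- minimum to use.
  rcases le_total w R with hwR | hwR
  · refine (mul_le_mul_of_nonneg_left ((min_le_right _ _).trans (min_le_left _ _))
      (by norm_num)).trans ?_
    rw [div_mul_div_comm, div_le_div_iff₀ (by positivity) (by positivity)]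
    have : (R + w) * (R + w + 2 * β) ≤ 4 * (R ^ 2 + 2 * β * R) := by nlinarith
    have h2 : 0 < c0t * F := by positivity
    nlinarith
  · refine (mul_le_mul_of_nonneg_left (min_le_left _ _) (by norm_num)).trans ?_
    have h1 : K * F / (1 + β * (2 / w)) = 2 * c0t * F / (w ^ 2 + 2 * β * w) := by
      rw [hKw]
      field_simp
    rw [h1, div_mul_div_comm, div_le_div_iff₀ (by positivity) (by positivity)]
    have : (R + w) * (R + w + 2 * β) ≤ 4 * (w ^ 2 + 2 * β * w) := by nlinarith
    have h2 : 0 < c0t * F := by positivity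
    nlinarith

/-- The rate beyond distance `r₂`. -/
lemma c2_mul_le_of_r2_le (hK : 0 < K) (hR : 0 < R) (ha : 0 ≤ a) {r : ℝ} (hr : r2 K R ≤ r) :
    c2 J K L R h a * (a + r) ≤ K * phi J L R h R * r / 8 := by
  have hc := c0t_pos
  have hphi := phi_pos (J := J) (L := L) (R := R) (h := h) R
  have hr0 : 0 < r := hR.trans ((lt_r2 hK).trans_le hr)
  set D := 1 + (a + √h) * √(2 * K / c0t) with hD
  have hD0 : 0 < D := by positivity
  have h1 : c2 J K L R h a ≤ 1 / 8 * (K * phi J L R h R / D) := by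
    unfold c2
    gcongr
    exact min_le_left _ _
  have h2 : a + r ≤ D * r := by
    have hmul : √(2 * K / c0t) * √(2 * c0t / K) = 2 := by
      rw [← Real.sqrt_mul (by positivity), Real.sqrt_eq_iff_mul_self_eq (by positivity)
        (by positivity)]
      field_simp
    have h3 : √(2 * c0t / K) ≤ r := by
      unfold r2 at hr
      linarith
    have h4 : 2 ≤ √(2 * K / c0t) * r := hmul.ge.trans (by gcongr)
    have h5 : a * 2 ≤ (a + √h) * (√(2 * K / c0t) * r) := by
      gcongr
      linarith [Real.sqrt_nonneg h]
    rw [hD]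
    nlinarith
  calc c2 J K L R h a * (a + r) ≤ 1 / 8 * (K * phi J L R h R / D) * (D * r) := by gcongr
    _ = K * phi J L R h R * r / 8 := by
      field_simp

lemma c2_mul_le_cRate (hJ : 0 ≤ J) (hK : 0 < K) (hL : 0 < L) (hR : 0 < R) (hh : 0 < h) (ha : 0 ≤ a)
    (hhr : √h < r2 K R) (hLr : L * √h * r2 K R < 1 / 8) :
    c2 J K L R h a * h ≤ 2 * (cRate J K L R h a).toReal := by
  have hc := c0t_pos
  have hphi := phi_pos (J := J) (L := L) (R := R) (h := h) R
  have hs : 0 < √h := Real.sqrt_pos.2 hh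
  have hr2 : 0 < r2 K R := hs.trans hhr
  have h1 : ENNReal.ofReal (c2 J K L R h a * h / 2) ≤ cRate J K L R h a := by
    refine le_min (ENNReal.ofReal_le_ofReal ?_) ?_
    · linarith [c2_mul_le (J := J) (K := K) (L := L) (R := R) (a := a) hh, p0_pos]
    · refine le_trans ?_ (mul_le_mul' le_rfl
        (ENNReal.inv_le_inv.2 (G_r2_le hJ hL hR hh ha hhr hLr)))
      rw [← ENNReal.ofReal_inv_of_pos (by positivity),
        show (4⁻¹ : ℝ≥0∞) = ENNReal.ofReal 4⁻¹ by
          rw [ENNReal.ofReal_inv_of_pos (by norm_num), ENNReal.ofReal_ofNat],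
        ← ENNReal.ofReal_mul (by norm_num)]
      apply ENNReal.ofReal_le_ofReal
      have h2 := c2_le_div (J := J) (L := L) (h := h) hK hR ha
      calc c2 J K L R h a * h / 2
          ≤ c0t * phi J L R h R / (r2 K R * (r2 K R + 2 * (a + √h))) * h / 2 := by gcongr
        _ = _ := by
          field_simp
          norm_num
  have h2 := (ENNReal.ofReal_le_iff_le_toReal cRate_ne_top).1 h1
  linarith

/-- Concavity of `f_a` to the left of `r ∈ (√h, r₂]`. -/
lemma slope_sub_ge (hJ : 0 ≤ J) (hL : 0 < L) (hR : 0 < R) (hh : 0 < h) (ha : 0 ≤ a)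
    (hLr : L * √h * r2 K R < 1 / 8) {r t D : ℝ} (hr : √h < r) (hr2 : r ≤ r2 K R)
    (ht : t ∈ Set.Ioo (r - √h) r) (hD : D ≤ h * Lam J L h * r) (hDR : R ≤ r → D ≤ 0) :
    (2 * (cRate J K L R h a).toReal * (a + Phi J L R h r) + D * slope J K L R h a r) / (c0t * h) *
      (r - t) ≤ slope J K L R h a t - slope J K L R h a r := by
  have hc := c0t_pos
  have hs : 0 < √h := Real.sqrt_pos.2 hh
  have ht0 : 0 ≤ t := by linarith [ht.1]
  have htr : 0 ≤ r - t := by linarith [ht.2]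
  have hpost := phi_pos (J := J) (L := L) (R := R) (h := h) t
  have hposr := phi_pos (J := J) (L := L) (R := R) (h := h) r
  have hP := Phi_nonneg (J := J) (L := L) (R := R) (h := h) (hs.trans hr).le
  have hLr' : L * √h * r ≤ 1 / 4 := by
    have : L * √h * r ≤ L * √h * r2 K R := by gcongr
    linarith
  have hG := le_G (a := a) hL hh hJ hR.le ht0 ht.2.le ht.1.le hr hLr'
  have hGr : G J L R h a r ≠ ∞ :=
    (((G_mono hr2).trans (G_r2_le hJ hL hR hh ha (hr.trans_le hr2) hLr)).trans_lt
      ENNReal.ofReal_lt_top).ne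
  have hGt : G J L R h a t ≠ ∞ := ((G_mono ht.2.le).trans_lt hGr.lt_top).ne
  have hG' := ENNReal.toReal_mono hGr hG
  rw [ENNReal.toReal_add hGt ENNReal.ofReal_ne_top, ENNReal.toReal_ofReal (by positivity)] at hG'
  set C := (cRate J K L R h a).toReal with hC
  have hC0 : 0 ≤ C := ENNReal.toReal_nonneg
  -- Discrete product rule: the slope difference is `(g(t) - g(r)) φ(t) + g(r) (φ(t) - φ(r))`. This
  -- bounds the first part, with `φ(t)` cancelling the `1/φ` in `G`; `h3` bounds the second.
  have h1 : 2 * C * ((r - t) * ((a + Phi J L R h r) / (c0t * h))) ≤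
      (ga J K L R h a t - ga J K L R h a r) * phi J L R h t := by
    have h2 : ga J K L R h a t - ga J K L R h a r =
        2 * C * ((G J L R h a r).toReal - (G J L R h a t).toReal) := by
      simp only [ga, ENNReal.toReal_mul, ← hC]
      ring
    calc 2 * C * ((r - t) * ((a + Phi J L R h r) / (c0t * h)))
        = 2 * C * ((r - t) * (1 / phi J L R h t * ((a + Phi J L R h r) / (c0t * h)))) *
          phi J L R h t := by
          field_simp
      _ ≤ _ := by
          rw [h2]
          gcongr
          linarith
  have hgr := (ga_mem_Icc (J := J) (L := L) (h := h) (a := a) hr2).1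
  have h3 : D * (ga J K L R h a r * phi J L R h r) / (c0t * h) * (r - t) ≤
      ga J K L R h a r * (phi J L R h t - phi J L R h r) := by
    rcases le_total r R with hrR | hrR
    · have h4 := phi_sub_ge hJ hL.le hh.le ht.2.le ht.1.le hrR
      have hl := Lam_nonneg hJ hL.le hh.le
      calc D * (ga J K L R h a r * phi J L R h r) / (c0t * h) * (r - t)
          ≤ h * Lam J L h * r * (ga J K L R h a r * phi J L R h r) / (c0t * h) * (r - t) := by
            gcongr
        _ = ga J K L R h a r * (phi J L R h r * (c0t⁻¹ * Lam J L h * r * (r - t))) := by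
            field_simp
        _ ≤ ga J K L R h a r * (phi J L R h r * (c0t⁻¹ * Lam J L h * (2 * r) * (r - t))) := by
            gcongr
            linarith
        _ ≤ _ := by gcongr
    · have h5 : phi J L R h r ≤ phi J L R h t :=
        phi_antitoneOn hJ hL.le hR.le hh.le ht0 (hs.trans hr).le ht.2.le
      have h6 : 0 ≤ -(D * (ga J K L R h a r * phi J L R h r)) := by
        have := hDR hrR
        have : 0 ≤ -D := by linarith
        rw [← neg_mul]
        positivity
      have h7 : 0 ≤ -(D * (ga J K L R h a r * phi J L R h r)) / (c0t * h) * (r - t) := by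
        positivity
      have h8 : 0 ≤ ga J K L R h a r * (phi J L R h t - phi J L R h r) :=
        mul_nonneg (by linarith) (by linarith)
      rw [neg_div, neg_mul] at h7
      linarith
  have hst : slope J K L R h a t = ga J K L R h a t * phi J L R h t := by
    rw [slope, min_eq_left (ht.2.le.trans hr2)]
  have hsr : slope J K L R h a r = ga J K L R h a r * phi J L R h r := by
    rw [slope, min_eq_left hr2]
  rw [hst, hsr]
  have h9 : (2 * C * (a + Phi J L R h r) + D * (ga J K L R h a r * phi J L R h r)) / (c0t * h) *
      (r - t) = 2 * C * ((r - t) * ((a + Phi J L R h r) / (c0t * h))) +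
        D * (ga J K L R h a r * phi J L R h r) / (c0t * h) * (r - t) := by
    ring
  rw [h9]
  linarith

end Rate

/-! ### Contraction for the distance process -/

section Contraction

variable {J K L R h a : ℝ}

open Classical in
/-- `ρ_a` as a function of the distance. -/
noncomputable def radial (J K L R h a s : ℝ) : ℝ :=
  (if s ≠ 0 then a else 0) + fa J K L R h a s

lemma rho_eq_radial {d : ℕ} (x y : EuclideanSpace ℝ (Fin d)) :
    rho J K L R h a x y = radial J K L R h a ‖x - y‖ := by
  simp [rho, radial, sub_eq_zero]

open Classical in
lemma integrable_ite_gap (q : ℝ) :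
    Integrable (fun p => if gap q p ≠ 0 then (1 : ℝ) else 0) noiseLaw := by
  refine Integrable.of_bound (Measurable.aestronglyMeasurable ?_) 1
    (Filter.Eventually.of_forall fun p => ?_)
  · exact Measurable.ite ((measurable_gap q) (measurableSet_singleton 0).compl) measurable_const
      measurable_const
  · split_ifs <;> simp

lemma radial_gap_eq (hh : 0 < h) (q : ℝ) (p : ℝ × ℝ) [Decidable (gap q p ≠ 0)] :
    radial J K L R h a (√h * gap q p) =
      a * (if gap q p ≠ 0 then 1 else 0) + fa J K L R h a (√h * gap q p) := by
  have hs : √h ≠ 0 := (Real.sqrt_pos.2 hh).ne'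
  by_cases hg : gap q p = 0 <;> simp [radial, hg, hs]

variable (hJ : 0 ≤ J) (hK : 0 < K) (hL : 0 < L) (hR : 0 < R) (hh : 0 < h)
include hJ hK hL hR hh

lemma integrable_fa_gap (q : ℝ) :
    Integrable (fun p => fa J K L R h a (√h * gap q p)) noiseLaw := by
  have hnn : ∀ p, 0 ≤ √h * gap q p := fun p => mul_nonneg (Real.sqrt_nonneg h) (gap_nonneg q p)
  -- Monotonicity is available only on `[0, ∞)`; truncating at 0 gives a globally monotone, hence
  -- measurable, function.
  have hmono : Monotone fun s => fa J K L R h a (max 0 s) := fun s t hst =>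
    fa_monotoneOn hJ hK hL.le hR.le hh.le (Set.mem_Ici.2 (le_max_left 0 s))
      (Set.mem_Ici.2 (le_max_left 0 t)) (max_le_max le_rfl hst)
  have hmeas : Measurable fun p => fa J K L R h a (√h * gap q p) := by
    have h1 := hmono.measurable.comp ((measurable_gap q).const_mul (√h))
    simp only [Function.comp_def, max_eq_right (hnn _)] at h1
    exact h1
  refine ((integrable_gap q).const_mul (√h)).mono hmeas.aestronglyMeasurable
    (Filter.Eventually.of_forall fun p => ?_)
  rw [Real.norm_of_nonneg (fa_nonneg (hnn p)), Real.norm_of_nonneg (hnn p)]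
  exact fa_le_self hJ hK hL.le hR.le hh.le (hnn p)

lemma integrable_radial_gap (q : ℝ) :
    Integrable (fun p => radial J K L R h a (√h * gap q p)) noiseLaw := by
  classical
  simp only [radial_gap_eq hh]
  exact ((integrable_ite_gap q).const_mul a).add (integrable_fa_gap hJ hK hL hR hh q)

open Classical in
lemma integral_radial_gap (q : ℝ) :
    ∫ p, radial J K L R h a (√h * gap q p) ∂noiseLaw =
      a * ∫ p, (if gap q p ≠ 0 then (1 : ℝ) else 0) ∂noiseLaw +
        ∫ p, fa J K L R h a (√h * gap q p) ∂noiseLaw := by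
  simp only [radial_gap_eq hh]
  rw [integral_add ((integrable_ite_gap q).const_mul a) (integrable_fa_gap hJ hK hL hR hh q),
    integral_const_mul]

lemma integral_fa_gap_le {r s : ℝ} (hr : 0 ≤ r) (hs : 0 < s) :
    ∫ p, fa J K L R h a (√h * gap (s / √h) p) ∂noiseLaw ≤
      fa J K L R h a r + slope J K L R h a r * (s - r) := by
  have hsq : 0 < √h := Real.sqrt_pos.2 hh
  have hg := (integrable_gap (s / √h)).const_mul (√h)
  have hg2 : Integrable (fun p => slope J K L R h a r * (√h * gap (s / √h) p - r)) noiseLaw :=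
    (hg.sub (integrable_const r)).const_mul _
  calc ∫ p, fa J K L R h a (√h * gap (s / √h) p) ∂noiseLaw
      ≤ ∫ p, (fa J K L R h a r + slope J K L R h a r * (√h * gap (s / √h) p - r)) ∂noiseLaw :=
        integral_mono (integrable_fa_gap hJ hK hL hR hh _)
          ((integrable_const _).add hg2)
          fun p => fa_le_tangent hJ hK hL.le hR.le hh.le hr (mul_nonneg hsq.le (gap_nonneg _ _))
    _ = _ := by
        rw [integral_add (integrable_const _) hg2,
          integral_const_mul, integral_sub hg (integrable_const r), integral_const_mul,
          integral_gap (by positivity), mul_div_cancel₀ _ hsq.ne']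
        simp

/-- The quadratic gap below the tangent is used only when the new distance lies in `(r - √h, r)`;
elsewhere the plain tangent bound suffices. -/
lemma integral_fa_gap_le_sub {r s m : ℝ} (hr : √h < r) (hs : 0 < s) (hsr : |s - r| ≤ √h / 8)
    (hm0 : 0 ≤ m) (hm : ∀ t ∈ Set.Ioo (r - √h) r,
      2 * m * (r - t) ≤ slope J K L R h a t - slope J K L R h a r) :
    ∫ p, fa J K L R h a (√h * gap (s / √h) p) ∂noiseLaw ≤
      fa J K L R h a r + slope J K L R h a r * (s - r) - m * h * (2 * c0t) := by
  have hsq : 0 < √h := Real.sqrt_pos.2 hh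
  have hg := (integrable_gap (s / √h)).const_mul (√h)
  have hg2 : Integrable (fun p => slope J K L R h a r * (√h * gap (s / √h) p - r)) noiseLaw :=
    (hg.sub (integrable_const r)).const_mul _
  have hg3 : Integrable (fun p => fa J K L R h a r +
      slope J K L R h a r * (√h * gap (s / √h) p - r)) noiseLaw := (integrable_const _).add hg2
  have hcut := (integrable_cutSq_gap (r / √h) (s / √h)).const_mul (m * h)
  have hr0 : 0 < r := hsq.trans hr
  have hmom : 2 * c0t ≤ ∫ p, cutSq (r / √h) (gap (s / √h) p) ∂noiseLaw := by
    refine le_integral_cutSq_gap ((one_lt_div hsq).2 hr) ?_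
    rw [← sub_div, abs_div, abs_of_pos hsq, div_le_iff₀ hsq]
    linarith
  calc ∫ p, fa J K L R h a (√h * gap (s / √h) p) ∂noiseLaw
      ≤ ∫ p, (fa J K L R h a r + slope J K L R h a r * (√h * gap (s / √h) p - r) -
          m * h * cutSq (r / √h) (gap (s / √h) p)) ∂noiseLaw := by
        refine integral_mono (integrable_fa_gap hJ hK hL hR hh _) (hg3.sub hcut) fun p => ?_
        have hnn : 0 ≤ √h * gap (s / √h) p := mul_nonneg hsq.le (gap_nonneg _ _)
        by_cases hmem : gap (s / √h) p ∈ Set.Ioo (r / √h - 1) (r / √h)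
        · have h1 : r - √h < √h * gap (s / √h) p := by
            have := mul_lt_mul_of_pos_left hmem.1 hsq
            rwa [mul_sub, mul_div_cancel₀ _ hsq.ne', mul_one] at this
          have h2 : √h * gap (s / √h) p < r := by
            have := mul_lt_mul_of_pos_left hmem.2 hsq
            rwa [mul_div_cancel₀ _ hsq.ne'] at this
          have h3 := integral_le_tangent_sub_sq (m := m)
            (slope_antitoneOn (a := a) hJ hK hL.le hR.le hh.le) hr0.le hnn h2.le
            fun t ht => hm t ⟨h1.trans ht.1, ht.2⟩
          have h4 : h * (gap (s / √h) p - r / √h) ^ 2 = (√h * gap (s / √h) p - r) ^ 2 := by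
            nth_rewrite 1 [← Real.sq_sqrt hh.le]
            rw [← mul_pow, mul_sub, mul_div_cancel₀ _ hsq.ne']
          dsimp only
          rw [cutSq, Set.indicator_of_mem hmem, mul_assoc m, h4]
          exact h3
        · dsimp only
          rw [cutSq, Set.indicator_of_notMem hmem, mul_zero, sub_zero]
          exact fa_le_tangent hJ hK hL.le hR.le hh.le hr0.le hnn
    _ = fa J K L R h a r + slope J K L R h a r * (s - r) -
          m * h * ∫ p, cutSq (r / √h) (gap (s / √h) p) ∂noiseLaw := by
        rw [integral_sub hg3 hcut, integral_add (integrable_const _) hg2,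
          integral_const_mul, integral_sub hg (integrable_const r), integral_const_mul,
          integral_gap (by positivity), mul_div_cancel₀ _ hsq.ne', integral_const_mul]
        simp
    _ ≤ _ := by gcongr

open Classical in
/-- One coupled step from distance `r`, whose deterministic part moves the distance to `s`,
contracts `ρ_a` in mean. -/
lemma integral_radial_gap_le (hlt : h < h0 K L R) (ha : 2 * √h ≤ a) {r s : ℝ} (hr : 0 < r)
    (hs : 0 < s) (hsr : |s - r| ≤ h * L * r) (hsL : s ≤ r + h * Lam J L h * r)
    (hsK : R ≤ r → s ≤ r - h * K / 2 * r) :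
    ∫ p, radial J K L R h a (√h * gap (s / √h) p) ∂noiseLaw ≤
      (1 - c2 J K L R h a * h) * (a + fa J K L R h a r) := by
  obtain ⟨hb1, -, hb3⟩ := h0_spec hK hL hR hh hlt
  have hsq : 0 < √h := Real.sqrt_pos.2 hh
  have ha0 : 0 < a := by linarith
  have hp1 := p0_le_one
  have hp0 := p0_pos
  have hc2 := c2_mul_le (J := J) (K := K) (L := L) (R := R) (a := a) hh
  have hc2n := c2_nonneg (J := J) (L := L) (a := a) hK hR hh ha0.le
  have hf0 := fa_nonneg (J := J) (K := K) (L := L) (R := R) (h := h) (a := a) hr.le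
  have hfr := fa_le_self (a := a) hJ hK hL.le hR.le hh.le hr.le
  have hw0 := slope_nonneg (J := J) (K := K) (L := L) (R := R) (h := h) (a := a) r
  have hl0 := Lam_nonneg hJ hL.le hh.le
  have hlL : Lam J L h ≤ L := min_le_left _ _
  have hI1 : ∫ p, (if gap (s / √h) p ≠ 0 then (1 : ℝ) else 0) ∂noiseLaw ≤ 1 := by
    calc _ ≤ ∫ _, (1 : ℝ) ∂noiseLaw := integral_mono (integrable_ite_gap _) (integrable_const _)
          fun p => by dsimp only; split_ifs <;> norm_num
      _ = 1 := by simp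
  rw [integral_radial_gap hJ hK hL hR hh]
  rcases le_or_gt r (√h) with hrh | hrh
  · have hq2 : s / √h ≤ 2 := by
      rw [div_le_iff₀ hsq]
      have : h * L * r ≤ 1 * r := by
        gcongr
        linarith
      linarith [(abs_le.1 hsr).2]
    have h1 := integral_gap_ne_zero_le (q := s / √h) (by positivity) hq2
    have h2 := integral_fa_gap_le (a := a) hJ hK hL hR hh hr.le hs
    have h3 := mul_slope_le_fa (a := a) hJ hK hL.le hR.le hh.le hr.le
    have h4 : slope J K L R h a r * (s - r) ≤ p0 / 2 * fa J K L R h a r := by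
      calc slope J K L R h a r * (s - r) ≤ slope J K L R h a r * (h * Lam J L h * r) := by
            gcongr
            linarith
        _ = h * Lam J L h * (slope J K L R h a r * r) := by ring
        _ ≤ p0 / 2 * fa J K L R h a r := by
            have : h * Lam J L h ≤ h * L := by gcongr
            have : 0 ≤ slope J K L R h a r * r := by positivity
            gcongr
            linarith
    have h5 : a * ∫ p, (if gap (s / √h) p ≠ 0 then (1 : ℝ) else 0) ∂noiseLaw ≤ a * (1 - p0) := by
      gcongr
    have h6 : c2 J K L R h a * h * (a + fa J K L R h a r) ≤ p0 / 2 * (a + fa J K L R h a r) := by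
      gcongr
    -- Closing needs `f(r) ≤ a/2`, which follows from `f(r) ≤ r ≤ √h` and `2√h ≤ a`.
    nlinarith
  have h1 : a * ∫ p, (if gap (s / √h) p ≠ 0 then (1 : ℝ) else 0) ∂noiseLaw ≤ a * 1 := by
    gcongr
  rcases le_or_gt r (r2 K R) with hr2 | hr2
  -- Only an outward drift must be compensated; the positive part also keeps the curvature `m`
  -- nonnegative.
  · set D := max (s - r) 0 with hD
    have hDl : D ≤ h * Lam J L h * r := max_le (by linarith) (by positivity)
    have hDR : R ≤ r → D ≤ 0 := fun hRr => by
      refine max_le ?_ le_rfl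
      have := hsK hRr
      have : 0 ≤ h * K / 2 * r := by positivity
      linarith
    have hP := Phi_nonneg (J := J) (L := L) (R := R) (h := h) hr.le
    have hc := c0t_pos
    set C := (cRate J K L R h a).toReal with hC
    have hC0 : 0 ≤ C := ENNReal.toReal_nonneg
    have hsr8 : |s - r| ≤ √h / 8 := by
      have h3 : L * √h * r ≤ 1 / 8 := le_trans (by gcongr) hb3.le
      calc |s - r| ≤ h * L * r := hsr
        _ = √h * (L * √h * r) := by
          nth_rewrite 1 [← Real.sq_sqrt hh.le]
          ring
        _ ≤ √h * (1 / 8) := by gcongr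
        _ = √h / 8 := by ring
    have h2 := integral_fa_gap_le_sub (a := a)
      (m := (2 * C * (a + Phi J L R h r) + D * slope J K L R h a r) / (c0t * h) / 2)
      hJ hK hL hR hh hrh hs hsr8 (by
        have : 0 ≤ D := le_max_right _ _
        positivity) fun t ht => by
          rw [mul_div_cancel₀ _ two_ne_zero]
          exact slope_sub_ge hJ hL hR hh ha0.le hb3 hrh hr2 ht hDl hDR
    have h3 : (2 * C * (a + Phi J L R h r) + D * slope J K L R h a r) / (c0t * h) / 2 * h *
        (2 * c0t) = 2 * C * (a + Phi J L R h r) + D * slope J K L R h a r := by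
      field_simp
    rw [h3] at h2
    have h4 : slope J K L R h a r * (s - r) ≤ D * slope J K L R h a r := by
      rw [mul_comm]
      gcongr
      exact le_max_left _ _
    have h5 : c2 J K L R h a * h * (a + fa J K L R h a r) ≤ 2 * C * (a + Phi J L R h r) := by
      have := fa_le_Phi (a := a) hJ hK hL.le hR.le hh.le hr.le hr2
      have := c2_mul_le_cRate hJ hK hL hR hh ha0.le (hrh.trans_le hr2) hb3
      gcongr
    linarith
  · have h2 := integral_fa_gap_le (a := a) hJ hK hL hR hh hr.le hs
    have h3 := hsK ((lt_r2 hK).le.trans hr2.le)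
    have hphi := phi_pos (J := J) (L := L) (R := R) (h := h) R
    have h4 := slope_ge (a := a) hJ hK hL.le hR.le hh.le hr.le
    have h5 : phi J L R h R / 2 * (h * K / 2 * r) ≤ slope J K L R h a r * (r - s) := by
      gcongr
      linarith
    have h6 := c2_mul_le_of_r2_le (J := J) (L := L) (h := h) hK hR ha0.le hr2.le
    have h7 : c2 J K L R h a * h * (a + fa J K L R h a r) ≤ K * phi J L R h R * r / 8 * h := by
      calc c2 J K L R h a * h * (a + fa J K L R h a r) ≤ c2 J K L R h a * h * (a + r) := by gcongr
        _ = c2 J K L R h a * (a + r) * h := by ring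
        _ ≤ _ := by gcongr
    have h8 : 0 ≤ K * phi J L R h R * r * h := by positivity
    nlinarith

end Contraction

/-! ### Law of the projected noise, and the main theorem -/

lemma hasLaw_noise {Ω : Type*} [MeasurableSpace Ω] {P : Measure Ω} [IsProbabilityMeasure P] {d : ℕ}
    {Z : Ω → EuclideanSpace ℝ (Fin d)} {U : Ω → ℝ}
    (hZ : HasLaw Z (stdGaussian (EuclideanSpace ℝ (Fin d))) P)
    (hU : HasLaw U (volume.restrict (Set.Ioo (0 : ℝ) 1)) P) (hZU : IndepFun Z U P)
    {e : EuclideanSpace ℝ (Fin d)} (he : ‖e‖ = 1) :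
    HasLaw (fun ω => (inner ℝ e (Z ω), U ω)) noiseLaw P := by
  have hN : HasLaw (fun ω => inner ℝ e (Z ω)) (gaussianReal 0 1) P :=
    (hasLaw_inner_stdGaussian he).comp hZ
  have hNU : IndepFun (fun ω => inner ℝ e (Z ω)) U P :=
    hZU.comp (φ := fun z => inner ℝ e z) (ψ := id) (by fun_prop) measurable_id
  exact (indepFun_iff_hasLaw_prodMk_prod hN hU).1 hNU

end EulerCoupling

theorem mainTheorem7 {d : ℕ}
    (b : EuclideanSpace ℝ (Fin d) → EuclideanSpace ℝ (Fin d))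
    (J K L R : ℝ) (hJ : 0 ≤ J) (hK : 0 < K) (hL : 0 < L) (hR : 0 < R)
    (hC1 : ∀ x y, inner ℝ (x - y) (b x - b y) ≤ J * ‖x - y‖ ^ 2)
    (hC2 : ∀ x y, R ≤ ‖x - y‖ → inner ℝ (x - y) (b x - b y) ≤ -K * ‖x - y‖ ^ 2)
    (hC3 : ∀ x y, ‖b x - b y‖ ≤ L * ‖x - y‖)
    (h : ℝ) (hh : 0 < h)
    (a : ℝ) (ha : a ∈ Set.Icc (2 * Real.sqrt h) (EulerCoupling.Phi J L R h R)) :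
    (EulerCoupling.ga J K L R h a 0 = 1 ∧
      (∀ s ∈ Set.Icc 0 (EulerCoupling.r2 K R),
        EulerCoupling.ga J K L R h a s ∈ Set.Icc (1 / 2 : ℝ) 1) ∧
      AntitoneOn (EulerCoupling.ga J K L R h a) (Set.Icc 0 (EulerCoupling.r2 K R))) ∧
    (h < EulerCoupling.h0 K L R →
      ∀ {Ω : Type*} [MeasurableSpace Ω] (P : Measure Ω) [IsProbabilityMeasure P]
        (Z : Ω → EuclideanSpace ℝ (Fin d)) (U : Ω → ℝ),
        HasLaw Z (stdGaussian (EuclideanSpace ℝ (Fin d))) P →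
        HasLaw U (volume.restrict (Set.Ioo (0 : ℝ) 1)) P →
        IndepFun Z U P →
        ∀ x y : EuclideanSpace ℝ (Fin d),
          Integrable (fun ω => EulerCoupling.rho J K L R h a
            (EulerCoupling.stepX b h x (Z ω)) (EulerCoupling.stepY b h x y (Z ω) (U ω))) P ∧
          ∫ ω, EulerCoupling.rho J K L R h a
              (EulerCoupling.stepX b h x (Z ω)) (EulerCoupling.stepY b h x y (Z ω) (U ω)) ∂P
            ≤ (1 - EulerCoupling.c2 J K L R h a * h) * EulerCoupling.rho J K L R h a x y) := by
  refine ⟨⟨EulerCoupling.ga_zero, fun s hs => EulerCoupling.ga_mem_Icc hs.2,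
    EulerCoupling.ga_antitoneOn.mono Set.Icc_subset_Iic_self⟩, ?_⟩
  intro hlt Ω _ P _ Z U hZ hU hZU x y
  open EulerCoupling in
  obtain ⟨hb1, hb2, -⟩ := h0_spec hK hL hR hh hlt
  have hp1 := p0_le_one
  rcases eq_or_ne x y with rfl | hxy
  · have h0 : (fun ω => rho J K L R h a (stepX b h x (Z ω)) (stepY b h x x (Z ω) (U ω)))
        =ᵐ[P] fun _ => 0 := by
      have hU1 : ∀ᵐ ω ∂P, U ω ≤ 1 := by
        rw [hU.ae_iff (p := fun u => u ≤ 1) (measurableSet_setOfPred.1 measurableSet_Iic)]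
        filter_upwards [ae_restrict_mem measurableSet_Ioo] with u hu using hu.2.le
      filter_upwards [hU1] with ω hω
      rw [stepX_eq_stepY hh x _ hω]
      simp [rho, fa_zero]
    refine ⟨(integrable_congr h0).2 (integrable_zero _ _ _), ?_⟩
    rw [integral_congr_ae h0]
    simp [rho, fa_zero]
  have hr : 0 < ‖x - y‖ := norm_pos_iff.2 (sub_ne_zero.2 hxy)
  have hsr := abs_norm_drift_sub_le hh.le (hC3 x y)
  -- Since `hL < p0/2 < 1`, the deterministic step is injective, so the reflection direction is a
  -- genuine unit vector.
  have hs : 0 < ‖drift b h x - drift b h y‖ := by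
    have : h * L * ‖x - y‖ < 1 * ‖x - y‖ := by
      gcongr
      linarith
    linarith [(abs_le.1 hsr).1]
  have hdxy : drift b h x ≠ drift b h y := sub_ne_zero.1 (norm_pos_iff.1 hs)
  have hlaw := hasLaw_noise hZ hU hZU (norm_unitDir hdxy)
  have hint := integrable_radial_gap (a := a) hJ hK hL hR hh (‖drift b h x - drift b h y‖ / √h)
  simp only [rho_eq_radial, norm_stepX_sub_stepY hh hdxy]
  constructor
  · rw [← hlaw.map_eq] at hint
    exact hint.comp_aemeasurable hlaw.aemeasurable
  · have hle := integral_radial_gap_le hJ hK hL hR hh hlt ha.1 hr hs hsr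
      (norm_drift_sub_le_Lam hh.le hJ (hC1 x y) (hC3 x y))
      fun hRr => norm_drift_sub_le_of_le hh.le hr hb2.le (hC2 x y hRr) (hC3 x y)
    have h1 := hlaw.integral_comp hint.aestronglyMeasurable
    simp only [Function.comp_def] at h1
    rw [h1, radial, if_pos hr.ne']
    exact hle
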